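/- Let $N \ge 2$ and let $m_1,\dots,m_N>0$ be masses. Let $\mathbb{E}_{cm}=\{q\in\mathbb{C}^N : \sum_a m_a q_a=0\}\cong\mathbb{C}^{N-1}$, with the mass inner product $\langle q,v\rangle=\sum_a m_a\,\mathrm{Re}(\bar q_a v_a)$, and let $S_{cm}=\{s\in\mathbb{E}_{cm}:\langle s,s\rangle=1\}\cong S^{2N-3}$. Let $\mathcal{C}$ denote the collision locus $\{q_a=q_b \text{ for some } a\neq b\}$, in $S_{cm}$ as well as in $\mathbb{CP}^{N-2}=\mathbb{P}(\mathbb{E}_{cm})$. The group $S^1$ of unit complex numbers acts on the blown-up phase space $[0,\infty)\times(S_{cm}\setminus\mathcal{C})\times\mathbb{E}_{cm}$ of the planar $N$-body problem by $u\cdot(r,s,y)=(r,us,uy)$; let $$\mathcal{P}_N=\big([0,\infty)\times(S_{cm}\setminus\mathcal{C})\times\mathbb{E}_{cm}\big)/S^1$$ be the quotient, with the quotient topology and smooth structure. The projection $[r,s,y]\mapsto(r,[s])$ maps $\mathcal{P}_N$ to $[0,\infty)\times(\mathbb{CP}^{N-2}\setminus\mathcal{C})$, and its fibres are vector spaces with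 $[r,s,y]+[r,s,y']=[r,s,y+y']$ and $c\,[r,s,y]=[r,s,cy]$. For $s\in S_{cm}\setminus\mathcal{C}$ and $y\in\mathbb{E}_{cm}$ let $y_{hor}$ be the orthogonal projection of $y$ onto the orthogonal complement of $\mathbb{C}s$, and let the shape velocity $[s,y_{hor}]\in T_{[s]}(\mathbb{CP}^{N-2}\setminus\mathcal{C})$ be the image of $y_{hor}$ under the differential at $s$ of the map $q\mapsto[q]$. Then $$\Phi:\mathcal{P}_N\to[0,\infty)\times T(\mathbb{CP}^{N-2}\setminus\mathcal{C})\times\mathbb{R}^2,\qquad \Phi([r,s,y])=\big(r,\,[s,y_{hor}],\,(\nu,\tilde J)\big),\quad \nu=\langle s,y\rangle,\ \tilde J=\langle is,y\rangle,$$ is well defined and is an isomorphism of smooth real vector bundles over $[0,\infty)\times(\mathbb{CP}^{N-2}\setminus\mathcal{C})$: it is a homeomorphism, it is smooth with smooth inverse, it covers the identity of the base, and it is an $\mathbb{R}$-linear isomorphism on each fibre. Moreover, for $r>0$, put $q=rs$ and $v=r^{-1/2}y$. Then $\tilde J=r^{-1/2}J(q,v)$, where $J(q,v)=\sum_a m_a\,q_a\wedge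 v_a$ is the total angular momentum. Along every collision-free curve $q(t)$ in $\mathbb{E}_{cm}$ that passes at time $t_0$ through $q$ with velocity $v$, the size $\sqrt{\langle q(t),q(t)\rangle}$ has derivative $r^{-1/2}\nu$ at $t_0$, and the shape $[q(t)]$ has velocity $r^{-3/2}\,[s,y_{hor}]$ at $t_0$ (so that, in the rescaled time $\tau$ with $dt=r^{3/2}d\tau$, they are $r\nu$ and $[s,y_{hor}]$). -/

import Mathlib

open Set Topology Module
open scoped Manifold ContDiff NNReal InnerProductSpace ComplexConjugate LinearAlgebra.Projectivization

noncomputable section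

namespace PlanarNBody

/-! ### Complex projective space as a manifold -/

theorem ne_zero_of_norm_one {V : Type*} [NormedAddCommGroup V] {v : V} (hv : ‖v‖ = 1) : v ≠ 0 :=
  norm_ne_zero_iff.1 (by simp [hv])

section Projective

variable {V : Type*} [NormedAddCommGroup V] [InnerProductSpace ℂ V]

/-- The topology of the projective space of `V`: the quotient topology from `V ∖ {0}`. -/
instance projTopology : TopologicalSpace (ℙ ℂ V) :=
  TopologicalSpace.coinduced (Projectivization.mk' ℂ) inferInstance

theorem isQuotientMap_mk' : IsQuotientMap (Projectivization.mk' ℂ : {v : V // v ≠ 0} → ℙ ℂ V) :=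
  ⟨⟨rfl⟩, Quotient.mk''_surjective⟩

/-- The affine open set `{[w] : ⟪v, w⟫ ≠ 0}` of projective space. -/
def affineSource (v : V) : Set (ℙ ℂ V) := {p | ⟪v, p.rep⟫_ℂ ≠ 0}

theorem mk_mem_affineSource (v w : V) (hw : w ≠ 0) :
    Projectivization.mk ℂ w hw ∈ affineSource v ↔ ⟪v, w⟫_ℂ ≠ 0 := by
  obtain ⟨a, ha⟩ := Projectivization.exists_smul_eq_mk_rep ℂ w hw
  rw [affineSource, mem_ofPred_eq, ← ha, Units.smul_def, inner_smul_right]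
  simp

theorem isOpen_affineSource (v : V) : IsOpen (affineSource v) := by
  rw [← isQuotientMap_mk'.isOpen_preimage]
  have : Projectivization.mk' ℂ ⁻¹' affineSource v = {w : {w : V // w ≠ 0} | ⟪v, (w : V)⟫_ℂ ≠ 0} := by
    ext w; exact mk_mem_affineSource v w w.2
  rw [this]
  exact isOpen_ne_fun (by fun_prop) continuous_const

variable {n : ℕ} [Fact (finrank ℂ V = n + 1)]

/-- Unitary coordinates on the orthogonal complement of `v ≠ 0`. -/
def perpCoord {v : V} (hv : v ≠ 0) : (ℂ ∙ v)ᗮ ≃ₗᵢ[ℂ] EuclideanSpace ℂ (Fin n) :=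
  (OrthonormalBasis.fromOrthogonalSpanSingleton n hv).repr

/-- The affine coordinate `w ↦ w / ⟪v, w⟫ - v` on `{w : ⟪v, w⟫ ≠ 0}`, for a unit vector `v`; it takes
its values in `v^⊥`. -/
def affineCoord {v : V} (hv : v ≠ 0) (w : V) : EuclideanSpace ℂ (Fin n) :=
  perpCoord hv ((ℂ ∙ v)ᗮ.orthogonalProjectionOnto ((⟪v, w⟫_ℂ)⁻¹ • w))

theorem affineCoord_rep {v : V} (hv : v ≠ 0) (w : V) (hw : w ≠ 0) :
    affineCoord (n := n) hv (Projectivization.mk ℂ w hw).rep = affineCoord hv w := by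
  obtain ⟨a, ha⟩ := Projectivization.exists_smul_eq_mk_rep ℂ w hw
  rw [affineCoord, affineCoord, ← ha, Units.smul_def, inner_smul_right, smul_smul]
  congr 3
  rw [mul_inv, mul_right_comm, inv_mul_cancel₀ a.ne_zero, one_mul]

theorem inner_add_perp {v : V} (hv : ‖v‖ = 1) (u : (ℂ ∙ v)ᗮ) : ⟪v, v + u⟫_ℂ = 1 := by
  rw [inner_add_right, Submodule.mem_orthogonal_singleton_iff_inner_right.1 u.2,
    inner_self_eq_norm_sq_to_K, hv]
  simp

theorem add_perp_ne_zero {v : V} (hv : ‖v‖ = 1) (u : (ℂ ∙ v)ᗮ) : v + u ≠ 0 := fun h => by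
  have := inner_add_perp hv u
  simp [h] at this

theorem orthogonalProjection_add_perp {v : V} (u : (ℂ ∙ v)ᗮ) :
    (ℂ ∙ v)ᗮ.orthogonalProjectionOnto (v + u) = u := by
  rw [map_add, Submodule.orthogonalProjectionOnto_mem_subspace_eq_self,
    Submodule.orthogonalProjectionOnto_orthogonal_apply_eq_zero (Submodule.mem_span_singleton_self v),
    zero_add]

theorem add_orthogonalProjection {v : V} (hv : ‖v‖ = 1) (w : V) (hw : ⟪v, w⟫_ℂ = 1) :
    v + ((ℂ ∙ v)ᗮ.orthogonalProjectionOnto w : V) = w := by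
  have h := Submodule.starProjection_add_starProjection_orthogonal (K := (ℂ ∙ v)) w
  rw [Submodule.starProjection_unit_singleton ℂ hv, hw, one_smul] at h
  exact h

/-- The standard affine chart of projective space around the line of the unit vector `v`:
`[w] ↦ w / ⟪v, w⟫ - v ∈ v^⊥ ≅ ℂⁿ`, with inverse `u ↦ [v + u]`. -/
def projChart (n : ℕ) [Fact (finrank ℂ V = n + 1)] {v : V} (hv : ‖v‖ = 1) :
    OpenPartialHomeomorph (ℙ ℂ V) (EuclideanSpace ℂ (Fin n)) where
  toFun p := affineCoord (ne_zero_of_norm_one hv) p.rep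
  invFun u := Projectivization.mk ℂ (v + (perpCoord (ne_zero_of_norm_one hv)).symm u)
    (add_perp_ne_zero hv _)
  source := affineSource v
  target := univ
  map_source' _ _ := mem_univ _
  map_target' u _ := by
    rw [mk_mem_affineSource, inner_add_perp hv]
    exact one_ne_zero
  left_inv' p hp := by
    induction p with | h w hw => ?_
    rw [mk_mem_affineSource] at hp
    rw [Projectivization.mk_eq_mk_iff']
    refine ⟨(⟪v, w⟫_ℂ)⁻¹, ?_⟩
    rw [affineCoord_rep, affineCoord, LinearIsometryEquiv.symm_apply_apply,
      add_orthogonalProjection hv]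
    rw [inner_smul_right, inv_mul_cancel₀ hp]
  right_inv' u _ := by
    rw [affineCoord_rep, affineCoord, inner_add_perp hv, inv_one, one_smul,
      orthogonalProjection_add_perp, LinearIsometryEquiv.apply_symm_apply]
  open_source := isOpen_affineSource v
  open_target := isOpen_univ
  continuousOn_toFun := by
    rw [isQuotientMap_mk'.continuousOn_isOpen_iff (isOpen_affineSource v)]
    have : (fun p : ℙ ℂ V => affineCoord (n := n) (ne_zero_of_norm_one hv) p.rep) ∘
        Projectivization.mk' ℂ = fun w : {w : V // w ≠ 0} =>
          affineCoord (ne_zero_of_norm_one hv) (w : V) := by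
      ext1 w; exact affineCoord_rep _ _ w.2
    rw [this]
    unfold affineCoord
    refine (LinearIsometryEquiv.continuous _).comp_continuousOn
      ((ContinuousLinearMap.continuous _).comp_continuousOn (ContinuousOn.smul
        (ContinuousOn.inv₀ (Continuous.continuousOn (by fun_prop)) ?_)
        (Continuous.continuousOn (by fun_prop))))
    intro w hw
    exact (mk_mem_affineSource v w w.2).1 hw
  continuousOn_invFun := by
    refine Continuous.continuousOn ?_
    have h : Continuous fun u : EuclideanSpace ℂ (Fin n) =>
        (⟨v + (perpCoord (ne_zero_of_norm_one hv)).symm u, add_perp_ne_zero hv _⟩ :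
          {w : V // w ≠ 0}) := by
      refine Continuous.subtype_mk (continuous_const.add
        (continuous_subtype_val.comp (LinearIsometryEquiv.continuous _))) _
    exact isQuotientMap_mk'.continuous.comp h

theorem norm_unitRep (p : ℙ ℂ V) : ‖((‖p.rep‖ : ℂ)⁻¹ • p.rep)‖ = 1 := by
  rw [norm_smul, norm_inv, Complex.norm_real, norm_norm,
    inv_mul_cancel₀ (norm_ne_zero_iff.2 p.rep_nonzero)]

/-- The manifold structure of `ℂℙⁿ`: the atlas of all affine charts. -/
instance projChartedSpace : ChartedSpace (EuclideanSpace ℂ (Fin n)) (ℙ ℂ V) where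
  atlas := {e | ∃ (v : V) (hv : ‖v‖ = 1), e = projChart n hv}
  chartAt p := projChart n (norm_unitRep p)
  mem_chart_source p := by
    change ⟪_, p.rep⟫_ℂ ≠ 0
    rw [inner_smul_left, inner_self_eq_norm_sq_to_K]
    have := norm_ne_zero_iff.2 p.rep_nonzero
    simp [this]
  chart_mem_atlas p := ⟨_, norm_unitRep p, rfl⟩

/-- Complex projective space is a smooth manifold (over the reals). -/
instance projIsManifold : IsManifold 𝓘(ℝ, EuclideanSpace ℂ (Fin n)) ∞ (ℙ ℂ V) := by
  refine isManifold_of_contDiffOn _ _ _ ?_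
  rintro _ _ ⟨v, hv, rfl⟩ ⟨v', hv', rfl⟩
  have hc : ContDiffOn ℂ ∞ (fun u : EuclideanSpace ℂ (Fin n) =>
      affineCoord (n := n) (ne_zero_of_norm_one hv')
        (v + ((perpCoord (ne_zero_of_norm_one hv)).symm u : V)))
      {u | ⟪v', v + ((perpCoord (ne_zero_of_norm_one hv)).symm u : V)⟫_ℂ ≠ 0} := by
    have hl : ContDiff ℂ ∞ (fun u : EuclideanSpace ℂ (Fin n) =>
        v + ((perpCoord (ne_zero_of_norm_one hv)).symm u : V)) :=
      contDiff_const.add ((Submodule.subtypeL (ℂ ∙ v)ᗮ).contDiff.comp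
        (perpCoord (n := n) (ne_zero_of_norm_one hv)).symm.contDiff)
    unfold affineCoord
    refine (LinearIsometryEquiv.contDiff _).comp_contDiffOn
      ((ContinuousLinearMap.contDiff _).comp_contDiffOn (ContDiffOn.smul (ContDiffOn.inv
        (((innerSL ℂ v').contDiff.comp hl).contDiffOn) fun u hu => hu) hl.contDiffOn))
  refine (hc.restrict_scalars ℝ).congr_mono ?_ ?_
  · intro u _
    exact affineCoord_rep _ _ _
  · rintro u ⟨hu, -⟩
    exact (mk_mem_affineSource _ _ _).1 hu.2

end Projective

/-! ### Smooth maps out of and into an orbit space -/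

section Orbit

variable {G X : Type*} [Group G] [MulAction G X]
  {E H : Type*} [NormedAddCommGroup E] [NormedSpace ℝ E] [TopologicalSpace H]
  [TopologicalSpace X] [ChartedSpace H X] (I : ModelWithCorners ℝ E H)
  {E' H' Y : Type*} [NormedAddCommGroup E'] [NormedSpace ℝ E'] [TopologicalSpace H']
  [TopologicalSpace Y] [ChartedSpace H' Y] (I' : ModelWithCorners ℝ E' H')

/-- A map `X / G → Y` is smooth for the quotient smooth structure iff its composite with the quotient
map `X → X / G` is smooth. -/
def SmoothFromQuotient (Φ : MulAction.orbitRel.Quotient G X → Y) : Prop :=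
  ContMDiff I I' ∞ fun x : X => Φ (Quotient.mk _ x)

/-- A map `Y → X / G` is smooth for the quotient smooth structure (the one for which the quotient map
`X → X / G` is a submersion) iff locally it lifts to a smooth map `Y → X`. -/
def SmoothToQuotient (Ψ : Y → MulAction.orbitRel.Quotient G X) : Prop :=
  ∀ y₀ : Y, ∃ U ∈ 𝓝 y₀, ∃ σ : Y → X, ContMDiffOn I' I ∞ σ U ∧ ∀ y ∈ U, Ψ y = Quotient.mk _ (σ y)

end Orbit

/-- The half line `[0, ∞)` as a one-dimensional manifold with boundary, with the inclusion into `ℝ` as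
global chart. -/
def halfLine : ModelWithCorners ℝ ℝ ℝ≥0 :=
  ModelWithCorners.ofConvexRange
    { toFun := fun r => (r : ℝ)
      invFun := Real.toNNReal
      source := univ
      target := Ici 0
      map_source' := fun r _ => r.2
      map_target' := fun _ _ => mem_univ _
      left_inv' := fun _ _ => Real.toNNReal_coe
      right_inv' := fun _ hx => Real.coe_toNNReal _ hx }
    rfl (convex_Ici 0) NNReal.continuous_coe continuous_real_toNNReal
    ⟨(1 : ℝ), by
      change (1 : ℝ) ∈ interior (Ici 0)
      rw [interior_Ici]
      exact mem_Ioi.2 one_pos⟩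

/-! ### Configurations in the centre-of-mass frame -/

/-- The masses of `N` bodies. -/
structure Masses (N : ℕ) where
  mass : Fin N → ℝ
  pos : ∀ a, 0 < mass a

variable {N : ℕ} (m : Masses N)

/-- The linear functional `q ↦ ∑ mₐ qₐ` on `ℂᴺ`. -/
def massMoment : (Fin N → ℂ) →ₗ[ℂ] ℂ :=
  ∑ a, (m.mass a : ℂ) • LinearMap.proj a

theorem massMoment_apply (q : Fin N → ℂ) : massMoment m q = ∑ a, (m.mass a : ℂ) * q a := by
  simp [massMoment]

/-- The centre-of-mass configuration space `𝔼_cm = {q ∈ ℂᴺ : ∑ mₐ qₐ = 0}`. It carries the norm of the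
mass inner product defined below. -/
def CMSpace : Type := LinearMap.ker (massMoment m)

instance : AddCommGroup (CMSpace m) := inferInstanceAs (AddCommGroup (LinearMap.ker (massMoment m)))

instance : Module ℂ (CMSpace m) := inferInstanceAs (Module ℂ (LinearMap.ker (massMoment m)))

instance : FiniteDimensional ℂ (CMSpace m) :=
  inferInstanceAs (FiniteDimensional ℂ (LinearMap.ker (massMoment m)))

/-- The inclusion of `𝔼_cm` into `ℂᴺ`. -/
def CMSpace.incl : CMSpace m →ₗ[ℂ] (Fin N → ℂ) := (LinearMap.ker (massMoment m)).subtype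

/-- `q a` is the position of body `a` in the configuration `q`. -/
instance : CoeFun (CMSpace m) fun _ => Fin N → ℂ := ⟨fun q => CMSpace.incl m q⟩

variable {m} in
@[simp] theorem CMSpace.add_apply (q v : CMSpace m) (a : Fin N) : (q + v) a = q a + v a :=
  congrFun (map_add (CMSpace.incl m) q v) a

variable {m} in
@[simp] theorem CMSpace.smul_apply (c : ℂ) (q : CMSpace m) (a : Fin N) : (c • q) a = c * q a :=
  congrFun (map_smul (CMSpace.incl m) c q) a

/-- The Hermitian form `(q, v) ↦ ∑ mₐ q̄ₐ vₐ`, whose real part is the mass inner product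
`⟨q, v⟩ = ∑ mₐ qₐ · vₐ`. -/
@[reducible]
def massCore : InnerProductSpace.Core ℂ (CMSpace m) where
  inner q v := ∑ a, (m.mass a : ℂ) * (conj (q a) * v a)
  conj_inner_symm q v := by
    simp only [map_sum, map_mul, Complex.conj_ofReal, Complex.conj_conj]
    exact Finset.sum_congr rfl fun a _ => by ring
  re_inner_nonneg q := by
    rw [map_sum]
    refine Finset.sum_nonneg fun a _ => ?_
    rw [← Complex.normSq_eq_conj_mul_self, ← Complex.ofReal_mul]
    exact mul_nonneg (m.pos a).le (Complex.normSq_nonneg _)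
  add_left q v w := by
    simp only [CMSpace.add_apply, map_add, ← Finset.sum_add_distrib]
    exact Finset.sum_congr rfl fun a _ => by ring
  smul_left q v c := by
    simp only [CMSpace.smul_apply, map_mul, Finset.mul_sum]
    exact Finset.sum_congr rfl fun a _ => by ring
  definite q h := by
    have h' : ∑ a, m.mass a * Complex.normSq (q a) = 0 := by
      rw [← Complex.ofReal_inj, Complex.ofReal_zero, ← h, Complex.ofReal_sum]
      exact Finset.sum_congr rfl fun a _ => by
        rw [Complex.ofReal_mul, Complex.normSq_eq_conj_mul_self]
    rw [Finset.sum_eq_zero_iff_of_nonneg fun a _ =>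
      mul_nonneg (m.pos a).le (Complex.normSq_nonneg _)] at h'
    apply Subtype.ext
    funext a
    have := h' a (Finset.mem_univ a)
    exact Complex.normSq_eq_zero.1 ((mul_eq_zero.1 this).resolve_left (m.pos a).ne')

/-- The norm of `𝔼_cm` is the size `r = √⟨q, q⟩`. -/
instance : NormedAddCommGroup (CMSpace m) := (massCore m).toNormedAddCommGroup

instance : InnerProductSpace ℂ (CMSpace m) := InnerProductSpace.ofCore (massCore m).toCore

/-- The mass inner product. -/
instance : InnerProductSpace ℝ (CMSpace m) := InnerProductSpace.complexToReal

variable {m} in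
theorem real_inner_eq (q v : CMSpace m) :
    ⟪q, v⟫_ℝ = ∑ a, m.mass a * ((q a).re * (v a).re + (q a).im * (v a).im) := by
  have : ⟪q, v⟫_ℂ = ∑ a, (m.mass a : ℂ) * (conj (q a) * v a) := rfl
  rw [real_inner_eq_re_inner ℂ, this, map_sum]
  refine Finset.sum_congr rfl fun a _ => ?_
  simp

theorem finrank_CMSpace [N.AtLeastTwo] : finrank ℂ (CMSpace m) = N - 1 := by
  have h := LinearMap.finrank_range_add_finrank_ker (massMoment m)
  have hs : LinearMap.range (massMoment m) = ⊤ := by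
    refine LinearMap.range_eq_top.2 (LinearMap.surjective ?_)
    have hN : 2 ≤ N := Nat.AtLeastTwo.prop
    intro h0
    have h1 := massMoment_apply m (Pi.single (⟨0, by omega⟩ : Fin N) 1)
    rw [h0, Finset.sum_eq_single (⟨0, by omega⟩ : Fin N) (fun b _ hb => by
        rw [Pi.single_eq_of_ne hb, mul_zero])
      (fun h => absurd (Finset.mem_univ _) h)] at h1
    simp only [LinearMap.zero_apply, Pi.single_eq_same, mul_one] at h1
    exact (m.pos _).ne' (Complex.ofReal_eq_zero.1 h1.symm)
  rw [hs, finrank_top, finrank_self, finrank_fin_fun] at h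
  change finrank ℂ (LinearMap.ker (massMoment m)) = _
  omega

instance [N.AtLeastTwo] : Fact (finrank ℂ (CMSpace m) = (N - 2) + 1) :=
  ⟨by
    have hN : 2 ≤ N := Nat.AtLeastTwo.prop
    rw [finrank_CMSpace]; omega⟩

instance [N.AtLeastTwo] : Fact (finrank ℝ (CMSpace m) = (2 * N - 3) + 1) :=
  ⟨by
    have hN : 2 ≤ N := Nat.AtLeastTwo.prop
    rw [finrank_real_of_complex, finrank_CMSpace]; omega⟩

variable {m}

/-- The total angular momentum `J(q, v) = ∑ mₐ qₐ ∧ vₐ`. -/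
def angularMomentum (q v : CMSpace m) : ℝ :=
  ∑ a, m.mass a * ((q a).re * (v a).im - (q a).im * (v a).re)

/-- No two of the bodies coincide. -/
def NoCollision (q : CMSpace m) : Prop := ∀ a b, a ≠ b → q a ≠ q b

theorem continuous_position (a : Fin N) : Continuous fun q : CMSpace m => q a :=
  LinearMap.continuous_of_finiteDimensional (LinearMap.proj a ∘ₗ CMSpace.incl m)

theorem isOpen_noCollision : IsOpen {q : CMSpace m | NoCollision q} := by
  simp only [NoCollision, ofPred_forall]
  exact isOpen_iInter_of_finite fun a => isOpen_iInter_of_finite fun b =>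
    isOpen_iInter_of_finite fun _ => isOpen_ne_fun (continuous_position a) (continuous_position b)

theorem noCollision_smul {c : ℂ} (hc : c ≠ 0) {q : CMSpace m} :
    NoCollision (c • q) ↔ NoCollision q := by
  simp [NoCollision, hc]

theorem NoCollision.ne_zero [N.AtLeastTwo] {q : CMSpace m} (h : NoCollision q) : q ≠ 0 := by
  rintro rfl
  have hN : 2 ≤ N := Nat.AtLeastTwo.prop
  refine h ⟨0, by omega⟩ ⟨1, by omega⟩ (by simp) ?_
  simp

variable (m)

/-- The configurations `q ∈ 𝔼_cm` without collisions. -/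
def freeConf : TopologicalSpace.Opens (CMSpace m) := ⟨{q | NoCollision q}, isOpen_noCollision⟩

/-- The sphere `S_cm = {⟨s, s⟩ = 1} ≅ S^{2N-3}` minus the collision locus. -/
def freeSphere : TopologicalSpace.Opens (Metric.sphere (0 : CMSpace m) 1) :=
  ⟨{s | NoCollision (s : CMSpace m)}, isOpen_noCollision.preimage continuous_subtype_val⟩

/-- The collision locus `𝒞 = {[q] : qₐ = q_b for some a ≠ b}` in `ℂℙ^{N-2} = ℙ(𝔼_cm)`. -/
def collisionLocus : Set (ℙ ℂ (CMSpace m)) :=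
  {p | ∃ a b : Fin N, a ≠ b ∧ p.rep a = p.rep b}

variable {m} in
theorem mk_mem_collisionLocus (q : CMSpace m) (hq : q ≠ 0) :
    Projectivization.mk ℂ q hq ∈ collisionLocus m ↔ ¬ NoCollision q := by
  obtain ⟨c, hc⟩ := Projectivization.exists_smul_eq_mk_rep ℂ q hq
  rw [← noCollision_smul c.ne_zero, ← Units.smul_def, hc]
  simp [collisionLocus, NoCollision]

theorem isClosed_collisionLocus : IsClosed (collisionLocus m) := by
  rw [← isQuotientMap_mk'.isClosed_preimage]
  have : Projectivization.mk' ℂ ⁻¹' collisionLocus m =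
      {q : {q : CMSpace m // q ≠ 0} | NoCollision (q : CMSpace m)}ᶜ := by
    ext q; exact mk_mem_collisionLocus (q : CMSpace m) q.2
  rw [this]
  exact (isOpen_noCollision.preimage continuous_subtype_val).isClosed_compl

/-- Shape space without collisions: `ℂℙ^{N-2} ∖ 𝒞`. -/
def shapeSpace : TopologicalSpace.Opens (ℙ ℂ (CMSpace m)) :=
  ⟨(collisionLocus m)ᶜ, (isClosed_collisionLocus m).isOpen_compl⟩

variable {m}

/-- A normalized collision-free configuration, as a collision-free configuration. -/
def toConf (s : freeSphere m) : freeConf m := ⟨(s : Metric.sphere (0 : CMSpace m) 1), s.2⟩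

/-- The action of rotations on normalized collision-free configurations. -/
instance : MulAction Circle (freeSphere m) where
  smul u s := ⟨⟨(u : ℂ) • (toConf s : CMSpace m), by
    rw [mem_sphere_zero_iff_norm, norm_smul, Circle.norm_coe, one_mul]
    exact mem_sphere_zero_iff_norm.1 s.1.2⟩, (noCollision_smul u.coe_ne_zero).2 s.2⟩
  one_smul s := Subtype.ext (Subtype.ext (by
    change ((1 : Circle) : ℂ) • _ = _
    rw [Circle.coe_one, one_smul]; rfl))
  mul_smul u v s := Subtype.ext (Subtype.ext (by
    change ((u * v : Circle) : ℂ) • _ = (u : ℂ) • ((v : ℂ) • _)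
    rw [Circle.coe_mul, mul_smul]))

theorem toConf_smul (u : Circle) (s : freeSphere m) :
    (toConf (u • s) : CMSpace m) = (u : ℂ) • (toConf s : CMSpace m) := rfl

variable (m)

/-- The blown-up centre-of-mass phase space without collisions, `[0, ∞) × (S_cm ∖ 𝒞) × 𝔼_cm`. -/
abbrev PhaseSpace : Type := ℝ≥0 × freeSphere m × CMSpace m

/-- Rotations act by `u · (r, s, y) = (r, u s, u y)`. -/
instance : MulAction Circle (PhaseSpace m) where
  smul u x := (x.1, u • x.2.1, (u : ℂ) • x.2.2)
  one_smul x := by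
    change (x.1, (1 : Circle) • x.2.1, ((1 : Circle) : ℂ) • x.2.2) = x
    simp
  mul_smul u v x := by
    change (x.1, (u * v) • x.2.1, ((u * v : Circle) : ℂ) • x.2.2) =
      (x.1, u • v • x.2.1, (u : ℂ) • (v : ℂ) • x.2.2)
    rw [Circle.coe_mul, mul_smul, mul_smul]

/-- The blown-up reduced phase space `𝒫_N = ([0, ∞) × (S_cm ∖ 𝒞) × 𝔼_cm) / S¹`, with the quotient
topology. -/
abbrev ReducedPhaseSpace : Type := MulAction.orbitRel.Quotient Circle (PhaseSpace m)

variable {m}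

/-- The class `[r, s, y]` in the reduced phase space. -/
def ReducedPhaseSpace.mk (r : ℝ≥0) (s : freeSphere m) (y : CMSpace m) : ReducedPhaseSpace m :=
  Quotient.mk _ (r, s, y)

theorem ReducedPhaseSpace.mk_eq_iff {r r' : ℝ≥0} {s s' : freeSphere m} {y y' : CMSpace m} :
    mk r s y = mk r' s' y' ↔ ∃ u : Circle, r' = r ∧ u • s' = s ∧ (u : ℂ) • y' = y := by
  rw [mk, mk, Quotient.eq]
  change _ ∈ MulAction.orbit _ _ ↔ _
  rw [MulAction.mem_orbit_iff]
  refine exists_congr fun u => ?_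
  change (r', u • s', (u : ℂ) • y') = (r, s, y) ↔ _
  simp

variable [N.AtLeastTwo]

/-- The shape `[q] ∈ ℂℙ^{N-2} ∖ 𝒞` of a collision-free configuration. -/
def shape (q : freeConf m) : shapeSpace m :=
  ⟨Projectivization.mk ℂ (q : CMSpace m) (NoCollision.ne_zero q.2), fun h =>
    (mk_mem_collisionLocus _ _).1 h q.2⟩

theorem shape_eq_iff {s s' : freeSphere m} :
    shape (toConf s) = shape (toConf s') ↔ ∃ u : Circle, u • s' = s := by
  refine Subtype.ext_iff.trans ((Projectivization.mk_eq_mk_iff' ℂ _ _ _ _).trans ?_)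
  have hn : ∀ s : freeSphere m, ‖(toConf s : CMSpace m)‖ = 1 := fun s =>
    mem_sphere_zero_iff_norm.1 s.1.2
  constructor
  · rintro ⟨c, hc⟩
    have h := congrArg norm hc
    rw [norm_smul, hn, hn, mul_one] at h
    exact ⟨⟨c, mem_sphere_zero_iff_norm.2 h⟩, Subtype.ext (Subtype.ext hc)⟩
  · rintro ⟨u, rfl⟩
    exact ⟨u, rfl⟩

theorem exists_shape_eq (p : shapeSpace m) : ∃ s : freeSphere m, shape (toConf s) = p := by
  obtain ⟨p, hp⟩ := p
  induction p with | h q hq => ?_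
  have hc : ((‖q‖ : ℂ)⁻¹) ≠ 0 := by simp [hq]
  have hq' : NoCollision q := not_not.1 fun h => hp ((mk_mem_collisionLocus q hq).2 h)
  refine ⟨⟨⟨(‖q‖ : ℂ)⁻¹ • q, ?_⟩, (noCollision_smul hc).2 hq'⟩, Subtype.ext ?_⟩
  · rw [mem_sphere_zero_iff_norm, norm_smul, norm_inv, Complex.norm_real, norm_norm,
      inv_mul_cancel₀ (norm_ne_zero_iff.2 hq)]
  · exact (Projectivization.mk_eq_mk_iff' ℂ _ _ _ _).2 ⟨_, rfl⟩

/-- The projection `[r, s, y] ↦ (r, [s])` of the reduced phase space to `[0, ∞) × (ℂℙ^{N-2} ∖ 𝒞)`. -/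
def ReducedPhaseSpace.proj : ReducedPhaseSpace m → ℝ≥0 × shapeSpace m :=
  Quotient.lift (fun x => (x.1, shape (toConf x.2.1))) (by
    rintro ⟨r, s, y⟩ ⟨r', s', y'⟩ h
    obtain ⟨u, rfl, hs, -⟩ := ReducedPhaseSpace.mk_eq_iff.1 (Quotient.sound h)
    exact Prod.ext rfl (shape_eq_iff.2 ⟨u, hs⟩))

/-! ### The fibres of the reduced phase space are vector spaces -/

/-- The fibre of `𝒫_N → [0, ∞) × (ℂℙ^{N-2} ∖ 𝒞)` over `b`. -/
def Fiber (b : ℝ≥0 × shapeSpace m) : Type :=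
  {z : ReducedPhaseSpace m // ReducedPhaseSpace.proj z = b}

/-- For `b = (r, [s])`, the bijection `y ↦ [r, s, y]` of `𝔼_cm` with the fibre over `b`. -/
def fiberEquiv (b : ℝ≥0 × shapeSpace m) (s : freeSphere m) (hs : shape (toConf s) = b.2) :
    CMSpace m ≃ Fiber b :=
  Equiv.ofBijective (fun y => ⟨ReducedPhaseSpace.mk b.1 s y, Prod.ext rfl hs⟩) (by
    constructor
    · intro y y' h
      obtain ⟨u, -, hu, huy⟩ := ReducedPhaseSpace.mk_eq_iff.1 (congrArg Subtype.val h)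
      have hu1 : (u : ℂ) = 1 := by
        have h2 : (u : ℂ) • (toConf s : CMSpace m) = (1 : ℂ) • (toConf s : CMSpace m) := by
          rw [← toConf_smul, hu, one_smul]
        exact smul_left_injective ℂ (NoCollision.ne_zero s.2) h2
      rw [← huy, hu1, one_smul]
    · rintro ⟨z, rfl⟩
      induction z using Quotient.inductionOn with | h x => ?_
      obtain ⟨r, s', y'⟩ := x
      obtain ⟨u, hu⟩ := shape_eq_iff.1 hs
      exact ⟨(u : ℂ) • y', Subtype.ext (ReducedPhaseSpace.mk_eq_iff.2 ⟨u, rfl, hu, rfl⟩)⟩)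

/-- The addition of a fibre: `[r, s, y] + [r, s, y'] = [r, s, y + y']`. -/
instance (b : ℝ≥0 × shapeSpace m) : AddCommGroup (Fiber b) :=
  (fiberEquiv b _ (exists_shape_eq b.2).choose_spec).symm.addCommGroup

/-- The scalar multiplication of a fibre: `c • [r, s, y] = [r, s, c • y]`. -/
instance (b : ℝ≥0 × shapeSpace m) : Module ℂ (Fiber b) :=
  (fiberEquiv b _ (exists_shape_eq b.2).choose_spec).symm.module ℂ

theorem fiberEquiv_eq {b : ℝ≥0 × shapeSpace m} {s s' : freeSphere m} (hs : shape (toConf s) = b.2)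
    (hs' : shape (toConf s') = b.2) :
    ∃ u : ℂ, ∀ y, fiberEquiv b s hs y = fiberEquiv b s' hs' (u • y) := by
  obtain ⟨u, hu⟩ := shape_eq_iff.1 (hs'.trans hs.symm)
  exact ⟨u, fun y => Subtype.ext
    (ReducedPhaseSpace.mk_eq_iff.2 ⟨u, rfl, hu, rfl⟩).symm⟩

/-- The vector space structure of a fibre does not depend on the representative `s`. -/
theorem fiberEquiv_add_smul (b : ℝ≥0 × shapeSpace m) (s : freeSphere m)
    (hs : shape (toConf s) = b.2) (c : ℂ) (y y' : CMSpace m) :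
    fiberEquiv b s hs (c • y + y') = c • fiberEquiv b s hs y + fiberEquiv b s hs y' := by
  obtain ⟨u, hu⟩ := fiberEquiv_eq hs (exists_shape_eq b.2).choose_spec
  rw [hu, hu, hu, smul_add, smul_comm u c]
  set e := fiberEquiv b _ (exists_shape_eq b.2).choose_spec with he
  have h1 : ∀ z w : Fiber b, z + w = e (e.symm z + e.symm w) := fun _ _ => rfl
  have h2 : ∀ z : Fiber b, c • z = e (c • e.symm z) := fun _ => rfl
  rw [h2, h1]
  simp

/-! ### Velocities -/

/-- The horizontal part `y_hor` of `y` at `s`: its orthogonal projection, for the mass inner product,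
onto the orthogonal complement of the complex line `ℂ s`. -/
def horizontal (s : freeSphere m) (y : CMSpace m) : CMSpace m :=
  (ℂ ∙ (toConf s : CMSpace m))ᗮ.starProjection y

/-- The real manifold model of `ℂℙ^{N-2}`. -/
abbrev ShapeModel (N : ℕ) : Type := EuclideanSpace ℂ (Fin (N - 2))

/-- The tangent bundle `T(ℂℙ^{N-2} ∖ 𝒞)`. -/
abbrev ShapeTangent (m : Masses N) : Type := TangentBundle 𝓘(ℝ, ShapeModel N) (shapeSpace m)

/-- The shape velocity `[s, y_hor]`: the tangent vector of `ℂℙ^{N-2} ∖ 𝒞` at `[s]` that is the image of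
`y_hor` under the differential at `s` of `q ↦ [q]`. -/
def shapeVelocity (s : freeSphere m) (y : CMSpace m) : ShapeTangent m :=
  ⟨shape (toConf s), mfderiv 𝓘(ℝ, CMSpace m) 𝓘(ℝ, ShapeModel N) shape (toConf s) (horizontal s y)⟩

/-- The model with corners of the blown-up phase space `[0, ∞) × (S_cm ∖ 𝒞) × 𝔼_cm`. -/
abbrev phaseModel (m : Masses N) :=
  halfLine.prod ((𝓡 (2 * N - 3)).prod 𝓘(ℝ, CMSpace m))

/-- The total space `[0, ∞) × T(ℂℙ^{N-2} ∖ 𝒞) × ℝ²`. -/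
abbrev ProductBundle (m : Masses N) : Type := ℝ≥0 × ShapeTangent m × (ℝ × ℝ)

/-- The model with corners of `[0, ∞) × T(ℂℙ^{N-2} ∖ 𝒞) × ℝ²`. -/
abbrev productModel (N : ℕ) :=
  halfLine.prod ((𝓘(ℝ, ShapeModel N)).tangent.prod 𝓘(ℝ, ℝ × ℝ))

end PlanarNBody

end

open PlanarNBody

/-! Let `π` be the map `q ↦ [q]`. Its differential at `s` is onto, with kernel exactly `ℂ s`, and
the Hermitian product `⟪s, y⟫ = ν + i J̃` reads off the component of `y` along `ℂ s`. Hence `y ↦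
(dπ_s y, ν, J̃)` is a real linear isomorphism of `𝔼_cm` with `T_[s] × ℝ²`
(`bijective_velocityCoord`). Since `dπ_s` kills `ℂ s`, replacing `y` by `y_hor` does not change the
first component.

The map `π` is homogeneous of degree zero, so `dπ_{cq}(c h) = dπ_q(h)` for `c ≠ 0`
(`shapeDeriv_smul_smul`). For `c` in the circle this makes `Φ` well defined. For `c = r` it gives
the factor `r^{-3/2}`, because `r^{-1/2} y = r · r^{-3/2} y`. As the unit representatives of a shape
form one circle orbit, bijectivity of `Φ` reduces to the linear statement at a single `s`.

Smoothness comes from an explicit formula for `dπ` in affine charts (`affineDeriv`), used both in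
the preferred chart at `[q]` and in a fixed chart near it. The inverse is lifted locally by
normalizing the affine representative to get `s`, lifting the tangent vector by an explicit right
inverse of `affineDeriv`, and replacing its component along `ℂ s` by `(ν + i J̃) s`. Smoothness in
both directions yields the homeomorphism. -/

noncomputable section

namespace PlanarNBody

/-! ### The derivative of the affine coordinate on projective space -/

section AffineDerivative

variable {V : Type*} [NormedAddCommGroup V] [InnerProductSpace ℂ V]
  {n : ℕ} [Fact (finrank ℂ V = n + 1)]

/-- The orthogonal projection to `v^⊥` in unitary coordinates. -/
def perpProj {v : V} (hv : v ≠ 0) : V →L[ℂ] EuclideanSpace ℂ (Fin n) :=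
  (perpCoord hv).toContinuousLinearEquiv.toContinuousLinearMap ∘L
    (ℂ ∙ v)ᗮ.orthogonalProjectionOnto

theorem perpProj_perpCoord_symm {v : V} (hv : v ≠ 0) (u : EuclideanSpace ℂ (Fin n)) :
    perpProj hv ((perpCoord hv).symm u : V) = u := by
  change perpCoord hv ((ℂ ∙ v)ᗮ.orthogonalProjectionOnto _) = u
  rw [Submodule.orthogonalProjectionOnto_mem_subspace_eq_self, LinearIsometryEquiv.apply_symm_apply]

theorem eq_zero_of_perpProj_eq_zero {v : V} (hv : v ≠ 0) {w : V} (hw : ⟪v, w⟫_ℂ = 0)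
    (h : perpProj (n := n) hv w = 0) : w = 0 := by
  change perpCoord hv ((ℂ ∙ v)ᗮ.orthogonalProjectionOnto w) = 0 at h
  rw [LinearIsometryEquiv.map_eq_zero_iff] at h
  have hw' : w ∈ (ℂ ∙ v)ᗮ := Submodule.mem_orthogonal_singleton_iff_inner_right.2 hw
  simpa using (Submodule.orthogonalProjectionOnto_mem_subspace_eq_self
    (K := (ℂ ∙ v)ᗮ) ⟨w, hw'⟩).symm.trans h

/-- The derivative at `w` of the affine coordinate. -/
def affineDeriv {v : V} (hv : v ≠ 0) (w : V) : V →L[ℂ] EuclideanSpace ℂ (Fin n) :=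
  perpProj hv ∘L ((⟪v, w⟫_ℂ)⁻¹ • ContinuousLinearMap.id ℂ V -
    ((⟪v, w⟫_ℂ ^ 2)⁻¹ • innerSL ℂ v).smulRight w)

theorem affineDeriv_apply {v : V} (hv : v ≠ 0) (w h : V) :
    affineDeriv (n := n) hv w h =
      perpProj hv ((⟪v, w⟫_ℂ)⁻¹ • h - ((⟪v, w⟫_ℂ ^ 2)⁻¹ * ⟪v, h⟫_ℂ) • w) := rfl

theorem hasFDerivAt_affineCoord {v : V} (hv : v ≠ 0) {w : V} (hw : ⟪v, w⟫_ℂ ≠ 0) :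
    HasFDerivAt (affineCoord (n := n) hv) (affineDeriv hv w) w := by
  have h1 : HasFDerivAt (fun w : V => (⟪v, w⟫_ℂ)⁻¹) (-(⟪v, w⟫_ℂ ^ 2)⁻¹ • innerSL ℂ v) w :=
    (hasDerivAt_inv hw).comp_hasFDerivAt w (innerSL ℂ v).hasFDerivAt
  have h2 := (perpProj (n := n) hv).hasFDerivAt.comp w (h1.smul (hasFDerivAt_id w))
  refine h2.congr_fderiv ?_
  ext1 h
  rw [affineDeriv_apply]
  simp [sub_eq_add_neg]

/-- The affine coordinate is constant on complex lines. In the formula the two terms cancel, also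
when `⟪v, w⟫ = 0`, where both inverses are `0`. -/
theorem affineDeriv_smul_self {v : V} (hv : v ≠ 0) (w : V) (c : ℂ) :
    affineDeriv (n := n) hv w (c • w) = 0 := by
  have : (⟪v, w⟫_ℂ)⁻¹ • w - ((⟪v, w⟫_ℂ ^ 2)⁻¹ * ⟪v, w⟫_ℂ) • w = 0 := by
    rw [← sub_smul]
    field_simp
    simp
  rw [map_smul, affineDeriv_apply, this, map_zero, smul_zero]

/-- With the previous result, the kernel is exactly `ℂ w`. The vector to which `perpProj` is applied
is already orthogonal to `v`, and `perpProj` is injective there; so that vector vanishes, which can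
be solved for `h`. -/
theorem exists_eq_smul_of_affineDeriv_eq_zero {v : V} (hv : v ≠ 0) {w h : V} (hw : ⟪v, w⟫_ℂ ≠ 0)
    (hh : affineDeriv (n := n) hv w h = 0) : ∃ c : ℂ, h = c • w := by
  rw [affineDeriv_apply] at hh
  have := eq_zero_of_perpProj_eq_zero hv (by
    rw [inner_sub_right, inner_smul_right, inner_smul_right]
    field_simp
    simp) hh
  refine ⟨⟪v, w⟫_ℂ * ((⟪v, w⟫_ℂ ^ 2)⁻¹ * ⟪v, h⟫_ℂ), ?_⟩
  rw [mul_smul, ← sub_eq_zero.1 this, smul_inv_smul₀ hw]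

/-- A right inverse that is explicit in `w` and `u`: it gives surjectivity of the differential and,
later, a smooth lift of tangent vectors. -/
theorem affineDeriv_perpCoord_symm {v : V} (hv : v ≠ 0) {w : V} (hw : ⟪v, w⟫_ℂ ≠ 0)
    (u : EuclideanSpace ℂ (Fin n)) :
    affineDeriv hv w (⟪v, w⟫_ℂ • ((perpCoord hv).symm u : V)) = u := by
  have hu : ⟪v, ((perpCoord hv).symm u : V)⟫_ℂ = 0 :=
    Submodule.mem_orthogonal_singleton_iff_inner_right.1 ((perpCoord hv).symm u).2
  rw [affineDeriv_apply, inv_smul_smul₀ hw, inner_smul_right, hu, mul_zero, mul_zero, zero_smul,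
    sub_zero, perpProj_perpCoord_symm]

/-- The affine coordinate has degree zero in `w`, so its derivative has degree `-1`. -/
theorem affineDeriv_smul_smul {v : V} (hv : v ≠ 0) (w h : V) {c : ℂ} (hc : c ≠ 0) :
    affineDeriv (n := n) hv (c • w) (c • h) = affineDeriv hv w h := by
  rw [affineDeriv_apply, affineDeriv_apply, inner_smul_right, inner_smul_right, smul_smul, smul_smul]
  congr 3 <;> field_simp

theorem contDiffOn_affineCoord {v : V} (hv : v ≠ 0) :
    ContDiffOn ℂ ∞ (affineCoord (n := n) hv) {x | ⟪v, x⟫_ℂ ≠ 0} := by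
  unfold affineCoord
  exact (LinearIsometryEquiv.contDiff _).comp_contDiffOn
    ((ContinuousLinearMap.contDiff _).comp_contDiffOn (ContDiffOn.smul (ContDiffOn.inv
      (innerSL ℂ v).contDiff.contDiffOn fun u hu => hu) contDiffOn_id))

end AffineDerivative

/-! ### Derivatives into and out of open subsets of a vector space -/

section OpensTangent

variable {E : Type*} [NormedAddCommGroup E] [NormedSpace ℝ E] (U : TopologicalSpace.Opens E)
  {F : Type*} [NormedAddCommGroup F] [NormedSpace ℝ F]

theorem hasMFDerivAt_opens_subtypeVal (x : U) :
    HasMFDerivAt 𝓘(ℝ, E) 𝓘(ℝ, E) (Subtype.val : U → E) x (ContinuousLinearMap.id ℝ E) := by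
  refine ⟨continuous_subtype_val.continuousAt, ?_⟩
  -- The inverse chart of `U` is the true inverse only on `U`, so the two maps agree near `x` and
  -- not everywhere.
  have : writtenInExtChartAt 𝓘(ℝ, E) 𝓘(ℝ, E) x (Subtype.val : U → E) =ᶠ[𝓝 (x : E)] id := by
    have := TopologicalSpace.Opens.chartAt_subtype_val_symm_eventuallyEq (H := E) U (x := x)
    filter_upwards [this] with y hy
    exact hy.symm
  exact ((hasFDerivAt_id (𝕜 := ℝ) (x : E)).congr_of_eventuallyEq this).hasFDerivWithinAt

variable {U} in
theorem hasMFDerivAt_opens_of_hasFDerivAt {f : U → F} {g : E → F} {g' : E →L[ℝ] F} {x : U}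
    (hg : HasFDerivAt g g' x) (hf : ∀ y : U, f y = g y) :
    HasMFDerivAt 𝓘(ℝ, E) 𝓘(ℝ, F) f x g' := by
  have : f = g ∘ Subtype.val := funext hf
  rw [this]
  exact hg.hasMFDerivAt.comp x (hasMFDerivAt_opens_subtypeVal U x)

variable {U} in
theorem hasMFDerivAt_opens_curve {q : ℝ → U} {t : ℝ} {v : E}
    (hq : HasDerivAt (fun t => (q t : E)) v t) :
    HasMFDerivAt 𝓘(ℝ, ℝ) 𝓘(ℝ, E) q t (ContinuousLinearMap.toSpanSingleton ℝ v) := by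
  refine ⟨(Topology.IsInducing.subtypeVal.continuousAt_iff).2 hq.continuousAt, ?_⟩
  have : writtenInExtChartAt 𝓘(ℝ, ℝ) 𝓘(ℝ, E) t q = fun t => (q t : E) := by
    ext t; rfl
  rw [this]
  exact hq.hasFDerivAt.hasFDerivWithinAt

end OpensTangent

/-! ### Horizontal parts, `ν`, `J̃` and angular momentum -/

variable {N : ℕ} {m : Masses N}

/-- The unit representative of `p` whose affine chart is the preferred chart at `p`. -/
def unitRep (p : shapeSpace m) : CMSpace m := (‖p.1.rep‖ : ℂ)⁻¹ • p.1.rep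

theorem norm_unitRep_eq_one (p : shapeSpace m) : ‖unitRep p‖ = 1 := norm_unitRep p.1

theorem unitRep_ne_zero (p : shapeSpace m) : unitRep p ≠ 0 :=
  ne_zero_of_norm_one (norm_unitRep_eq_one p)

theorem norm_toConf (s : freeSphere m) : ‖(toConf s : CMSpace m)‖ = 1 :=
  mem_sphere_zero_iff_norm.1 s.1.2

theorem horizontal_eq (s : freeSphere m) (y : CMSpace m) :
    horizontal s y = y - ⟪(toConf s : CMSpace m), y⟫_ℂ • (toConf s : CMSpace m) := by
  rw [horizontal, eq_sub_iff_add_eq', ← Submodule.starProjection_unit_singleton ℂ (norm_toConf s)]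
  exact Submodule.starProjection_add_starProjection_orthogonal (K := ℂ ∙ (toConf s : CMSpace m)) y

/-- Thus `ν` and `J̃` are the real and imaginary parts of one Hermitian product. -/
theorem inner_I_smul_left (q v : CMSpace m) : ⟪Complex.I • q, v⟫_ℝ = (⟪q, v⟫_ℂ).im := by
  rw [real_inner_eq_re_inner ℂ, inner_smul_left]
  simp

section

variable {E H M : Type*} [NormedAddCommGroup E] [NormedSpace ℝ E]
  [TopologicalSpace H] {I : ModelWithCorners ℝ E H} [TopologicalSpace M] [ChartedSpace H M]
  {U : Set M} {f g : M → CMSpace m}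

theorem contMDiffOn_inner (hf : ContMDiffOn I 𝓘(ℝ, CMSpace m) ∞ f U)
    (hg : ContMDiffOn I 𝓘(ℝ, CMSpace m) ∞ g U) :
    ContMDiffOn I 𝓘(ℝ, ℝ) ∞ (fun x => ⟪f x, g x⟫_ℝ) U :=
  ((innerSL ℝ (E := CMSpace m)).contMDiff.comp_contMDiffOn hf).clm_apply hg

theorem contMDiffOn_complex_smul {a : M → ℂ} (ha : ContMDiffOn I 𝓘(ℝ, ℂ) ∞ a U)
    (hf : ContMDiffOn I 𝓘(ℝ, CMSpace m) ∞ f U) :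
    ContMDiffOn I 𝓘(ℝ, CMSpace m) ∞ (fun x => a x • f x) U :=
  ((ContinuousLinearMap.lsmul ℝ ℂ (E := CMSpace m)).contMDiff.comp_contMDiffOn ha).clm_apply hf

end

/-- The velocity at `s` with horizontal part that of `h`, and with given `ν` and `J̃`. -/
def assembleVelocity (s : freeSphere m) (h : CMSpace m) (c : ℝ × ℝ) : CMSpace m :=
  horizontal s h + ((c.1 : ℂ) + c.2 * Complex.I) • (toConf s : CMSpace m)

/-- With the projection replaced by real inner products, smooth dependence on `s` becomes visible.
-/
theorem assembleVelocity_eq (s : freeSphere m) (h : CMSpace m) (c : ℝ × ℝ) :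
    assembleVelocity s h c = h + (c.1 - ⟪(toConf s : CMSpace m), h⟫_ℝ) • (toConf s : CMSpace m) +
      (c.2 - ⟪Complex.I • (toConf s : CMSpace m), h⟫_ℝ) •
        (Complex.I • (toConf s : CMSpace m)) := by
  have hi : ⟪(toConf s : CMSpace m), h⟫_ℂ = (⟪(toConf s : CMSpace m), h⟫_ℝ : ℂ) +
      (⟪Complex.I • (toConf s : CMSpace m), h⟫_ℝ : ℂ) * Complex.I := by
    rw [inner_I_smul_left, real_inner_eq_re_inner ℂ]
    exact (Complex.re_add_im _).symm
  rw [assembleVelocity, horizontal_eq, hi]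
  simp only [← Complex.coe_smul]
  push_cast
  module

theorem angularMomentum_eq_inner (q v : CMSpace m) :
    angularMomentum q v = ⟪Complex.I • q, v⟫_ℝ := by
  rw [real_inner_eq, angularMomentum]
  refine Finset.sum_congr rfl fun a _ => ?_
  rw [CMSpace.smul_apply, Complex.I_mul_re, Complex.I_mul_im]
  ring

theorem inner_I_smul_eq_angularMomentum {r : ℝ} (hr : 0 < r) (q y : CMSpace m) :
    ⟪Complex.I • q, y⟫_ℝ =
      r ^ (-1 / 2 : ℝ) * angularMomentum (r • q) (r ^ (-1 / 2 : ℝ) • y) := by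
  -- `J` is bilinear, so it contributes `r · r^{-1/2}`; with the prefactor `r^{-1/2}` the exponents
  -- sum to zero.
  have h : r ^ (-1 / 2 : ℝ) * (r * r ^ (-1 / 2 : ℝ)) = 1 := by
    rw [mul_left_comm, ← Real.rpow_add hr]
    norm_num [Real.rpow_neg_one, hr.ne']
  rw [angularMomentum_eq_inner, smul_comm, real_inner_smul_left, real_inner_smul_right,
    ← mul_assoc, ← mul_assoc, mul_assoc (r ^ _), h, one_mul]

variable [N.AtLeastTwo]

/-! ### The differential of `q ↦ [q]` in affine charts -/

section ShapeDerivative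

theorem contDiffAt_affineCoord_real {v : CMSpace m} (hv : v ≠ 0) {q : CMSpace m}
    (hq : ⟪v, q⟫_ℂ ≠ 0) : ContDiffAt ℝ ∞ (affineCoord (n := N - 2) hv) q :=
  ((contDiffOn_affineCoord hv).contDiffAt
    ((isOpen_ne_fun (by fun_prop) continuous_const).mem_nhds hq)).restrict_scalars ℝ

/-- The chart is defined through a chosen representative of the line, but the affine coordinate does
not depend on that choice. -/
theorem extChartAt_shape (p : shapeSpace m) (q : freeConf m) :
    extChartAt 𝓘(ℝ, ShapeModel N) p (shape q) = affineCoord (unitRep_ne_zero p) (q : CMSpace m) :=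
  affineCoord_rep _ _ (NoCollision.ne_zero q.2)

theorem shape_mem_chartAt_source (p : shapeSpace m) (q : freeConf m) :
    shape q ∈ (chartAt (ShapeModel N) p).source ↔ ⟪unitRep p, (q : CMSpace m)⟫_ℂ ≠ 0 := by
  rw [TopologicalSpace.Opens.chartAt_eq, OpenPartialHomeomorph.subtypeRestr_source]
  exact mk_mem_affineSource _ _ _

theorem continuous_shape : Continuous (shape (m := m)) := by
  refine Continuous.subtype_mk ?_ _
  exact isQuotientMap_mk'.continuous.comp
    (continuous_subtype_val.subtype_mk fun q => NoCollision.ne_zero q.2)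

theorem inner_unitRep_shape_ne_zero (q : freeConf m) :
    ⟪unitRep (shape q), (q : CMSpace m)⟫_ℂ ≠ 0 :=
  (shape_mem_chartAt_source _ _).1 (mem_chart_source _ _)

theorem contMDiff_shape :
    ContMDiff 𝓘(ℝ, CMSpace m) 𝓘(ℝ, ShapeModel N) ∞ (shape (m := m)) := by
  intro q
  rw [contMDiffAt_iff_target]
  refine ⟨continuous_shape.continuousAt, ?_⟩
  have h : extChartAt 𝓘(ℝ, ShapeModel N) (shape q) ∘ shape =
      fun q' : freeConf m => affineCoord (unitRep_ne_zero (shape q)) (q' : CMSpace m) :=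
    funext fun q' => extChartAt_shape _ q'
  rw [h]
  exact (contDiffAt_affineCoord_real _ (inner_unitRep_shape_ne_zero q)).contMDiffAt.comp q
    contMDiff_subtype_val.contMDiffAt

/-- The derivative of `q ↦ [q]` in the preferred chart at `[q]`. -/
def shapeDeriv (q : freeConf m) : CMSpace m →L[ℝ] ShapeModel N :=
  (affineDeriv (unitRep_ne_zero (shape q)) (q : CMSpace m)).restrictScalars ℝ

theorem hasFDerivAt_affineCoord_real {v : CMSpace m} (hv : v ≠ 0) {q : CMSpace m}
    (hq : ⟪v, q⟫_ℂ ≠ 0) :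
    HasFDerivAt (affineCoord (n := N - 2) hv) ((affineDeriv hv q).restrictScalars ℝ) q :=
  (hasFDerivAt_affineCoord hv hq).restrictScalars ℝ

/-- Near `q` this is the Fréchet derivative of a smooth map. -/
theorem contDiffAt_affineDeriv_real {v : CMSpace m} (hv : v ≠ 0) {q : CMSpace m}
    (hq : ⟪v, q⟫_ℂ ≠ 0) :
    ContDiffAt ℝ ∞ (fun q => (affineDeriv (n := N - 2) hv q).restrictScalars ℝ) q := by
  refine ((contDiffAt_affineCoord_real (N := N) hv hq).fderiv_right (m := ∞)
    (by simp)).congr_of_eventuallyEq ?_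
  have hopen : IsOpen {q : CMSpace m | ⟪v, q⟫_ℂ ≠ 0} :=
    isOpen_ne_fun (by fun_prop) continuous_const
  filter_upwards [hopen.mem_nhds hq] with q hq
  exact (hasFDerivAt_affineCoord_real hv hq).fderiv.symm

theorem mdifferentiableAt_shape (q : freeConf m) :
    MDifferentiableAt 𝓘(ℝ, CMSpace m) 𝓘(ℝ, ShapeModel N) shape q :=
  contMDiff_shape.mdifferentiableAt (by simp)

/-- Chain rule for chart after `shape`. The chart is centred at an independent `p`, so that one
chart serves for all nearby `q`. -/
theorem mfderiv_extChartAt_mfderiv_shape (p : shapeSpace m) (q : freeConf m)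
    (hq : ⟪unitRep p, (q : CMSpace m)⟫_ℂ ≠ 0) (h : CMSpace m) :
    mfderiv 𝓘(ℝ, ShapeModel N) 𝓘(ℝ, ShapeModel N) (extChartAt 𝓘(ℝ, ShapeModel N) p) (shape q)
      (mfderiv 𝓘(ℝ, CMSpace m) 𝓘(ℝ, ShapeModel N) shape q h) =
    affineDeriv (n := N - 2) (unitRep_ne_zero p) (q : CMSpace m) h := by
  have h1 : MDifferentiableAt 𝓘(ℝ, ShapeModel N) 𝓘(ℝ, ShapeModel N)
      (extChartAt 𝓘(ℝ, ShapeModel N) p) (shape q) :=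
    mdifferentiableAt_extChartAt ((shape_mem_chartAt_source p q).2 hq)
  have h2 := h1.hasMFDerivAt.comp q (mdifferentiableAt_shape q).hasMFDerivAt
  have h3 : HasMFDerivAt 𝓘(ℝ, CMSpace m) 𝓘(ℝ, ShapeModel N)
      (extChartAt 𝓘(ℝ, ShapeModel N) p ∘ shape) q
      ((affineDeriv (n := N - 2) (unitRep_ne_zero p) (q : CMSpace m)).restrictScalars ℝ) :=
    hasMFDerivAt_opens_of_hasFDerivAt (hasFDerivAt_affineCoord_real _ hq)
      fun q' => extChartAt_shape p q'
  exact congrArg (fun L : CMSpace m →L[ℝ] ShapeModel N => L h) (hasMFDerivAt_unique h2 h3)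

theorem trivializationAt_mfderiv_shape (p : shapeSpace m) (q : freeConf m)
    (hq : ⟪unitRep p, (q : CMSpace m)⟫_ℂ ≠ 0) (h : CMSpace m) :
    (trivializationAt (ShapeModel N) (TangentSpace 𝓘(ℝ, ShapeModel N)) p
      (⟨shape q, mfderiv 𝓘(ℝ, CMSpace m) 𝓘(ℝ, ShapeModel N) shape q h⟩ : ShapeTangent m)).2 =
    affineDeriv (n := N - 2) (unitRep_ne_zero p) (q : CMSpace m) h := by
  have hs := (shape_mem_chartAt_source p q).2 hq
  rw [← mfderiv_extChartAt_mfderiv_shape p q hq h,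
    ← TangentBundle.continuousLinearMapAt_trivializationAt hs]
  symm
  exact Bundle.Trivialization.continuousLinearMapAt_apply_of_mem (R := ℝ) _ hs _

/-- The tangent space at `[q]` is identified with the model through the preferred chart there, so in
these terms the differential is `affineDeriv` itself. -/
theorem hasMFDerivAt_shape (q : freeConf m) :
    HasMFDerivAt 𝓘(ℝ, CMSpace m) 𝓘(ℝ, ShapeModel N) shape q (shapeDeriv q) := by
  refine ⟨continuous_shape.continuousAt, ?_⟩
  have h : writtenInExtChartAt 𝓘(ℝ, CMSpace m) 𝓘(ℝ, ShapeModel N) q shape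
      =ᶠ[𝓝 (q : CMSpace m)] affineCoord (unitRep_ne_zero (shape q)) := by
    have := TopologicalSpace.Opens.chartAt_subtype_val_symm_eventuallyEq (H := CMSpace m) _ (x := q)
    filter_upwards [this] with y hy
    refine (extChartAt_shape _ _).trans (congrArg _ hy.symm)
  exact ((hasFDerivAt_affineCoord_real _
    (inner_unitRep_shape_ne_zero q)).congr_of_eventuallyEq h).hasFDerivWithinAt

theorem mfderiv_shape (q : freeConf m) :
    mfderiv 𝓘(ℝ, CMSpace m) 𝓘(ℝ, ShapeModel N) shape q = shapeDeriv q :=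
  (hasMFDerivAt_shape q).mfderiv

end ShapeDerivative

/-! ### The isomorphism of `𝔼_cm` with `T_[s] × ℝ²` -/

section Coordinates

theorem shapeDeriv_smul_self (q : freeConf m) (c : ℂ) :
    shapeDeriv q (c • (q : CMSpace m)) = 0 :=
  affineDeriv_smul_self (unitRep_ne_zero (shape q)) _ c

theorem shapeDeriv_horizontal (s : freeSphere m) (y : CMSpace m) :
    shapeDeriv (toConf s) (horizontal s y) = shapeDeriv (toConf s) y := by
  rw [horizontal_eq, map_sub, shapeDeriv_smul_self, sub_zero]

/-- Scaling a configuration and a velocity by `c` does not change the shape velocity. -/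
theorem shapeDeriv_smul_smul {q q' : freeConf m} {c : ℂ} (hc : c ≠ 0)
    (hq : (q' : CMSpace m) = c • (q : CMSpace m)) (h : CMSpace m) :
    shape q' = shape q ∧ shapeDeriv q' (c • h) = shapeDeriv q h := by
  have hs : shape q' = shape q :=
    Subtype.ext ((Projectivization.mk_eq_mk_iff' ℂ _ _ _ _).2 ⟨c, hq.symm⟩)
  refine ⟨hs, ?_⟩
  change affineDeriv (unitRep_ne_zero (shape q')) (q' : CMSpace m) (c • h) =
    affineDeriv (unitRep_ne_zero (shape q)) (q : CMSpace m) h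
  rw [hq, affineDeriv_smul_smul _ _ _ hc]
  congr 2
  rw [hs]

/-- The tangent vector `w` at `p` in the preferred chart at `p`. -/
def tangentMk (p : shapeSpace m) (w : ShapeModel N) : ShapeTangent m := ⟨p, w⟩

theorem shapeVelocity_eq (s : freeSphere m) (y : CMSpace m) :
    shapeVelocity s y = tangentMk (shape (toConf s)) (shapeDeriv (toConf s) y) := by
  rw [← shapeDeriv_horizontal, shapeVelocity, mfderiv_shape]
  rfl

theorem shapeVelocity_smul_smul (u : Circle) (s : freeSphere m) (y : CMSpace m) :
    shapeVelocity (u • s) ((u : ℂ) • y) = shapeVelocity s y := by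
  obtain ⟨h1, h2⟩ := shapeDeriv_smul_smul u.coe_ne_zero (toConf_smul u s) y
  rw [shapeVelocity_eq, shapeVelocity_eq, h1, h2]

/-- The shape velocity in the preferred chart, together with `ν` and `J̃`, as functions of `y`. -/
def velocityCoord (s : freeSphere m) : CMSpace m →ₗ[ℝ] ShapeModel N × (ℝ × ℝ) :=
  (shapeDeriv (toConf s)).toLinearMap.prod
    ((innerₛₗ ℝ (toConf s : CMSpace m)).prod (innerₛₗ ℝ (Complex.I • (toConf s : CMSpace m))))

theorem velocityCoord_apply (s : freeSphere m) (y : CMSpace m) :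
    velocityCoord s y = (shapeDeriv (toConf s) y,
      (⟪(toConf s : CMSpace m), y⟫_ℝ, ⟪Complex.I • (toConf s : CMSpace m), y⟫_ℝ)) := rfl

/-- The horizontal part is invisible to `⟪s, ·⟫` and the multiple of `s` is invisible to the
differential, so the components separate. -/
theorem velocityCoord_assembleVelocity (s : freeSphere m) (h : CMSpace m) (c : ℝ × ℝ) :
    velocityCoord s (assembleVelocity s h c) = (shapeDeriv (toConf s) h, c) := by
  have hi : ⟪(toConf s : CMSpace m), assembleVelocity s h c⟫_ℂ = (c.1 : ℂ) + c.2 * Complex.I := by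
    rw [assembleVelocity, horizontal_eq]
    simp [inner_self_eq_norm_sq_to_K, norm_toConf]
  rw [velocityCoord_apply, inner_I_smul_left, real_inner_eq_re_inner ℂ, hi, assembleVelocity, map_add,
    shapeDeriv_horizontal, shapeDeriv_smul_self, add_zero]
  simp

/-- A vector killed by the differential is `c • s`, and then `⟪s, c • s⟫ = c` has real part `ν` and
imaginary part `J̃`. Surjectivity feeds the explicit right inverse of `affineDeriv` into
`assembleVelocity`. -/
theorem bijective_velocityCoord (s : freeSphere m) : Function.Bijective (velocityCoord s) := by
  constructor
  · rw [← LinearMap.ker_eq_bot, LinearMap.ker_eq_bot']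
    intro y hy
    rw [velocityCoord_apply, inner_I_smul_left, real_inner_eq_re_inner ℂ, Prod.mk_eq_zero,
      Prod.mk_eq_zero] at hy
    obtain ⟨h1, h2, h3⟩ := hy
    obtain ⟨c, rfl⟩ := exists_eq_smul_of_affineDeriv_eq_zero (unitRep_ne_zero _)
      (inner_unitRep_shape_ne_zero (toConf s)) h1
    have hc : ⟪(toConf s : CMSpace m), c • (toConf s : CMSpace m)⟫_ℂ = 0 := Complex.ext h2 h3
    rw [inner_smul_right, inner_self_eq_norm_sq_to_K, norm_toConf] at hc
    simp at hc
    rw [hc, zero_smul]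
  · rintro ⟨w, c⟩
    exact ⟨assembleVelocity s _ c, (velocityCoord_assembleVelocity s _ c).trans
      (Prod.ext (affineDeriv_perpCoord_symm (unitRep_ne_zero _) (inner_unitRep_shape_ne_zero (toConf s)) w) rfl)⟩

/-- The isomorphism of `𝔼_cm` with `T_{[s]} × ℝ²`. -/
def velocityEquiv (s : freeSphere m) : CMSpace m ≃ₗ[ℝ] ShapeModel N × (ℝ × ℝ) :=
  LinearEquiv.ofBijective (velocityCoord s) (bijective_velocityCoord s)

/-- The linear isomorphism `y ↦ [r, s, y]` of `𝔼_cm` with the fibre over `(r, [s])`. -/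
def fiberLinearEquiv (b : ℝ≥0 × shapeSpace m) (s : freeSphere m) (hs : shape (toConf s) = b.2) :
    CMSpace m ≃ₗ[ℂ] Fiber b :=
  have hadd : ∀ y y', fiberEquiv b s hs (y + y') = fiberEquiv b s hs y + fiberEquiv b s hs y' :=
    fun y y' => by simpa using fiberEquiv_add_smul b s hs 1 y y'
  have hzero : fiberEquiv b s hs 0 = 0 := by simpa using hadd 0 0
  { fiberEquiv b s hs with
    map_add' := hadd
    map_smul' := fun c y => by simpa [hzero] using fiberEquiv_add_smul b s hs c y 0 }

end Coordinates

theorem shapeVelocity_eq_mfderiv (s : freeSphere m) (y : CMSpace m) :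
    shapeVelocity s y = ⟨shape (toConf s),
      mfderiv 𝓘(ℝ, CMSpace m) 𝓘(ℝ, ShapeModel N) shape (toConf s) y⟩ := by
  rw [shapeVelocity_eq, mfderiv_shape]
  rfl

/-! ### The map `Φ`: invariance, bijectivity, linearity on fibres -/

section Trivialization

/-- The map `[r, s, y] ↦ (r, [s, y_hor], (ν, J̃))`. -/
def reducedMap : ReducedPhaseSpace m → ProductBundle m :=
  Quotient.lift (fun x => (x.1, shapeVelocity x.2.1 x.2.2,
    (⟪(toConf x.2.1 : CMSpace m), x.2.2⟫_ℝ, ⟪Complex.I • (toConf x.2.1 : CMSpace m), x.2.2⟫_ℝ))) (by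
    rintro ⟨r, s, y⟩ ⟨r', s', y'⟩ h
    obtain ⟨u, rfl, rfl, rfl⟩ := ReducedPhaseSpace.mk_eq_iff.1 (Quotient.sound h)
    -- Unit complex numbers preserve the Hermitian product, hence both `ν` and `J̃`.
    have hi : ⟪(toConf (u • s') : CMSpace m), (u : ℂ) • y'⟫_ℂ =
        ⟪(toConf s' : CMSpace m), y'⟫_ℂ := by
      have h1 : (starRingEnd ℂ) (u : ℂ) * (u : ℂ) = 1 := by
        rw [← Complex.normSq_eq_conj_mul_self, Circle.normSq_coe, Complex.ofReal_one]
      rw [toConf_smul, inner_smul_left, inner_smul_right, ← mul_assoc, h1, one_mul]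
    refine Prod.ext rfl (Prod.ext (shapeVelocity_smul_smul u s' y') (Prod.ext ?_ ?_))
    · exact congrArg Complex.re hi
    · exact ((inner_I_smul_left _ _).trans (congrArg Complex.im hi)).trans
        (inner_I_smul_left _ _).symm)

theorem reducedMap_mk (r : ℝ≥0) (s : freeSphere m) (y : CMSpace m) :
    reducedMap (ReducedPhaseSpace.mk r s y) = (r, shapeVelocity s y,
      (⟪(toConf s : CMSpace m), y⟫_ℝ, ⟪Complex.I • (toConf s : CMSpace m), y⟫_ℝ)) := rfl

theorem reducedMap_mk_eq (r : ℝ≥0) (s : freeSphere m) (y : CMSpace m) :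
    reducedMap (ReducedPhaseSpace.mk r s y) =
      (r, tangentMk (shape (toConf s)) (velocityCoord s y).1, (velocityCoord s y).2) := by
  rw [reducedMap_mk, shapeVelocity_eq, velocityCoord_apply]

theorem bijective_reducedMap : Function.Bijective (reducedMap (m := m)) := by
  constructor
  · intro z z' h
    induction z using Quotient.inductionOn with | h x => ?_
    induction z' using Quotient.inductionOn with | h x' => ?_
    obtain ⟨r, s, y⟩ := x
    obtain ⟨r', s', y'⟩ := x'
    change reducedMap (ReducedPhaseSpace.mk r s y) = reducedMap (ReducedPhaseSpace.mk r' s' y') at h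
    have hs : shape (toConf s) = shape (toConf s') :=
      congrArg (fun x : ProductBundle m => x.2.1.proj) h
    obtain ⟨u, hu⟩ := shape_eq_iff.1 hs
    -- Rotating the second class onto the representative `s` puts both tangent vectors over the same
    -- base point, where `velocityCoord s` is injective.
    have hz : ReducedPhaseSpace.mk r' s' y' = ReducedPhaseSpace.mk r' s ((u : ℂ) • y') :=
      (ReducedPhaseSpace.mk_eq_iff.2 ⟨u, rfl, hu, rfl⟩).symm
    rw [hz, reducedMap_mk_eq, reducedMap_mk_eq, Prod.mk_inj, Prod.mk_inj] at h
    obtain ⟨rfl, h2, h3⟩ := h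
    have h2' : (velocityCoord s y).1 = (velocityCoord s ((u : ℂ) • y')).1 :=
      eq_of_heq (Bundle.TotalSpace.mk.inj h2).2
    have := (bijective_velocityCoord s).1 (Prod.ext h2' h3)
    exact (congrArg _ this).trans hz.symm
  · rintro ⟨r, ⟨p, w⟩, c⟩
    obtain ⟨s, rfl⟩ := exists_shape_eq p
    obtain ⟨y, hy⟩ := (bijective_velocityCoord s).2 (w, c)
    refine ⟨ReducedPhaseSpace.mk r s y, ?_⟩
    rw [reducedMap_mk_eq, hy]
    rfl

/-- The linear isomorphism of the fibre over `b` with `T_{b.2} × ℝ²`. -/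
def fiberVelocityEquiv (b : ℝ≥0 × shapeSpace m) :
    Fiber b ≃ₗ[ℝ] TangentSpace 𝓘(ℝ, ShapeModel N) b.2 × (ℝ × ℝ) :=
  ((fiberLinearEquiv b _ (exists_shape_eq b.2).choose_spec).restrictScalars ℝ).symm.trans
    (velocityEquiv (exists_shape_eq b.2).choose)

/-- The fibre over `b` has the linear structure of `𝔼_cm` through `y ↦ [r, s, y]`, and in this
parametrization `Φ` is the linear map `velocityCoord s`. -/
theorem reducedMap_fiber (b : ℝ≥0 × shapeSpace m) (z : Fiber b) :
    reducedMap z.1 = (b.1, ⟨b.2, (fiberVelocityEquiv b z).1⟩, (fiberVelocityEquiv b z).2) := by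
  obtain ⟨y, rfl⟩ := (fiberLinearEquiv b _ (exists_shape_eq b.2).choose_spec).surjective z
  have hy : velocityCoord _ y =
      fiberVelocityEquiv b (fiberLinearEquiv b _ (exists_shape_eq b.2).choose_spec y) :=
    congrArg (velocityEquiv (exists_shape_eq b.2).choose)
      (((fiberLinearEquiv b _ (exists_shape_eq b.2).choose_spec).restrictScalars
        ℝ).symm_apply_apply y).symm
  refine (reducedMap_mk_eq b.1 _ y).trans ?_
  rw [(exists_shape_eq b.2).choose_spec]
  exact congrArg (fun x : ShapeModel N × (ℝ × ℝ) => ((b.1, tangentMk b.2 x.1, x.2) :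
    ProductBundle m)) hy

end Trivialization

/-! ### Smoothness of `Φ` -/

section Smoothness

theorem contMDiff_coe_toConf :
    ContMDiff (𝓡 (2 * N - 3)) 𝓘(ℝ, CMSpace m) ∞ fun s : freeSphere m => (toConf s : CMSpace m) :=
  (contMDiff_coe_sphere (n := 2 * N - 3)).comp contMDiff_subtype_val

theorem contMDiff_toConf :
    ContMDiff (𝓡 (2 * N - 3)) 𝓘(ℝ, CMSpace m) ∞ (toConf (m := m)) :=
  (ContMDiff.subtypeVal_comp_iff _ _).1 contMDiff_coe_toConf

theorem contMDiff_shapeVelocity :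
    ContMDiff ((𝓡 (2 * N - 3)).prod 𝓘(ℝ, CMSpace m)) (𝓘(ℝ, ShapeModel N)).tangent ∞
      fun x : freeSphere m × CMSpace m => shapeVelocity x.1 x.2 := by
  have hq : ContMDiff ((𝓡 (2 * N - 3)).prod 𝓘(ℝ, CMSpace m)) 𝓘(ℝ, CMSpace m) ∞
      fun x : freeSphere m × CMSpace m => (toConf x.1 : CMSpace m) :=
    contMDiff_coe_toConf.comp contMDiff_fst
  have hshape : ContMDiff ((𝓡 (2 * N - 3)).prod 𝓘(ℝ, CMSpace m)) 𝓘(ℝ, ShapeModel N) ∞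
      fun x : freeSphere m × CMSpace m => shape (toConf x.1) :=
    contMDiff_shape.comp (contMDiff_toConf.comp contMDiff_fst)
  intro x₀
  -- It remains to treat the fibre coordinate in the fixed trivialization at the shape of `x₀`; near
  -- `x₀` it is `affineDeriv` applied to `y`.
  refine Bundle.contMDiffAt_totalSpace.2 ⟨hshape.contMDiffAt, ?_⟩
  set p := shape (toConf x₀.1) with hp
  have hD : ContMDiffAt ((𝓡 (2 * N - 3)).prod 𝓘(ℝ, CMSpace m)) 𝓘(ℝ, ShapeModel N) ∞
      (fun x : freeSphere m × CMSpace m =>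
        affineDeriv (n := N - 2) (unitRep_ne_zero p) (toConf x.1 : CMSpace m) x.2) x₀ := by
    have h := (contDiffAt_affineDeriv_real (unitRep_ne_zero p)
      (inner_unitRep_shape_ne_zero (toConf x₀.1))).contMDiffAt
    exact (h.comp x₀ hq.contMDiffAt).clm_apply contMDiffAt_snd
  refine hD.congr_of_eventuallyEq ?_
  have hev : ∀ᶠ x in 𝓝 x₀, shape (toConf x.1) ∈ (chartAt (ShapeModel N) p).source :=
    hshape.continuous.continuousAt.eventually
      ((chartAt (ShapeModel N) p).open_source.mem_nhds (mem_chart_source _ _))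
  filter_upwards [hev] with x hx
  change (trivializationAt (ShapeModel N) (TangentSpace 𝓘(ℝ, ShapeModel N)) p
    (shapeVelocity x.1 x.2)).2 = _
  rw [shapeVelocity_eq_mfderiv]
  exact trivializationAt_mfderiv_shape p (toConf x.1) ((shape_mem_chartAt_source _ _).1 hx) x.2

theorem smoothFromQuotient_reducedMap :
    SmoothFromQuotient (phaseModel m) (productModel N) (reducedMap (m := m)) := by
  have hs : ContMDiff (phaseModel m) 𝓘(ℝ, CMSpace m) ∞
      fun x : PhaseSpace m => (toConf x.2.1 : CMSpace m) :=
    contMDiff_coe_toConf.comp (contMDiff_fst.comp contMDiff_snd)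
  have hy : ContMDiff (phaseModel m) 𝓘(ℝ, CMSpace m) ∞ fun x : PhaseSpace m => x.2.2 :=
    contMDiff_snd.comp contMDiff_snd
  have hI : ContMDiff (phaseModel m) 𝓘(ℝ, CMSpace m) ∞
      fun x : PhaseSpace m => Complex.I • (toConf x.2.1 : CMSpace m) :=
    ((Complex.I • ContinuousLinearMap.id ℂ (CMSpace m)).restrictScalars ℝ).contMDiff.comp hs
  have hin : ∀ {f : PhaseSpace m → CMSpace m}, ContMDiff (phaseModel m) 𝓘(ℝ, CMSpace m) ∞ f →
      ContMDiff (phaseModel m) 𝓘(ℝ, ℝ) ∞ fun x => ⟪f x, x.2.2⟫_ℝ := fun hf =>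
    contMDiffOn_univ.1 (contMDiffOn_inner hf.contMDiffOn hy.contMDiffOn)
  exact contMDiff_fst.prodMk ((contMDiff_shapeVelocity.comp contMDiff_snd).prodMk
    (hin hs |>.prodMk_space (hin hI)))

end Smoothness

/-! ### Local sections and smoothness of the inverse -/

section LocalSection

/-- Passing to the open submanifold `U` reduces this to a globally defined map into the sphere. -/
theorem ContMDiffOn.of_coe_sphere {E : Type*} [NormedAddCommGroup E] [InnerProductSpace ℝ E] {n : ℕ}
    [Fact (finrank ℝ E = n + 1)] {F H M : Type*} [NormedAddCommGroup F] [NormedSpace ℝ F]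
    [TopologicalSpace H] {I : ModelWithCorners ℝ F H} [TopologicalSpace M] [ChartedSpace H M]
    [IsManifold I ∞ M] {f : M → Metric.sphere (0 : E) 1} {U : TopologicalSpace.Opens M}
    (hf : ContMDiffOn I 𝓘(ℝ, E) ∞ (fun x => (f x : E)) U) : ContMDiffOn I (𝓡 n) ∞ f U := by
  have h : ContMDiff I 𝓘(ℝ, E) ∞ fun x : U => (f x : E) := fun x =>
    contMDiffAt_subtype_iff.2 (hf.contMDiffAt (U.isOpen.mem_nhds x.2))
  have h' : ContMDiff I (𝓡 n) ∞ fun x : U => f x := h.codRestrict_sphere fun x => (f x).2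
  exact fun x hx => (contMDiffAt_subtype_iff.1 (h' ⟨x, hx⟩)).contMDiffWithinAt

/-- The domain of the preferred chart at `p`. -/
def chartDomain (p : shapeSpace m) : TopologicalSpace.Opens (shapeSpace m) :=
  ⟨(chartAt (ShapeModel N) p).source, (chartAt (ShapeModel N) p).open_source⟩

/-- The representative `q` of a shape near `p` with `⟪unitRep p, q⟫ = 1`. -/
def affineRep (p x : shapeSpace m) : CMSpace m :=
  unitRep p + ((perpCoord (n := N - 2) (unitRep_ne_zero p)).symm
    (extChartAt 𝓘(ℝ, ShapeModel N) p x) : CMSpace m)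

theorem affineRep_ne_zero (p x : shapeSpace m) : affineRep p x ≠ 0 :=
  add_perp_ne_zero (norm_unitRep_eq_one p) _

theorem mk_affineRep {p x : shapeSpace m} (hx : x ∈ chartDomain p) :
    Projectivization.mk ℂ (affineRep p x) (affineRep_ne_zero p x) = x.1 := by
  have hx' : x.1 ∈ (projChart (N - 2) (norm_unitRep p.1)).source := by
    have : x ∈ (chartAt (ShapeModel N) p).source := hx
    rwa [TopologicalSpace.Opens.chartAt_eq, OpenPartialHomeomorph.subtypeRestr_source] at this
  exact (projChart (N - 2) (norm_unitRep p.1)).left_inv hx'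

theorem contMDiffOn_affineRep (p : shapeSpace m) :
    ContMDiffOn 𝓘(ℝ, ShapeModel N) 𝓘(ℝ, CMSpace m) ∞ (affineRep p) (chartDomain p) := by
  have h1 : ContDiff ℂ ∞ fun u : ShapeModel N =>
      unitRep p + ((perpCoord (n := N - 2) (unitRep_ne_zero p)).symm u : CMSpace m) :=
    contDiff_const.add ((Submodule.subtypeL (ℂ ∙ unitRep p)ᗮ).contDiff.comp
      (perpCoord (n := N - 2) (unitRep_ne_zero p)).symm.contDiff)
  exact (h1.restrict_scalars ℝ).contMDiff.comp_contMDiffOn contMDiffOn_extChartAt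

/-- Near `p` the quotient map from `S_cm ∖ 𝒞` to shape space has a smooth section. -/
theorem exists_smooth_section (p : shapeSpace m) :
    ∃ σ : shapeSpace m → freeSphere m,
      ContMDiffOn 𝓘(ℝ, ShapeModel N) (𝓡 (2 * N - 3)) ∞ σ (chartDomain p) ∧
      ∀ x, shape (toConf (σ x)) = x := by
  have hex : ∀ x : shapeSpace m, ∃ s : freeSphere m, shape (toConf s) = x ∧
      (x ∈ chartDomain p →
        (toConf s : CMSpace m) = (‖affineRep p x‖)⁻¹ • affineRep p x) := by
    intro x
    -- Inside the chart the section is the normalized affine representative; outside, any unit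
    -- representative makes it total.
    by_cases hx : x ∈ chartDomain p
    · have hn := affineRep_ne_zero p x
      have hc : ((‖affineRep p x‖ : ℂ)⁻¹) ≠ 0 := by simp [hn]
      have hq : NoCollision (affineRep p x) := by
        by_contra h
        exact x.2 (mk_affineRep hx ▸ (mk_mem_collisionLocus _ hn).2 h)
      refine ⟨⟨⟨(‖affineRep p x‖ : ℂ)⁻¹ • affineRep p x, ?_⟩, (noCollision_smul hc).2 hq⟩,
        Subtype.ext ?_, fun _ => ?_⟩
      · rw [mem_sphere_zero_iff_norm, norm_smul, norm_inv, Complex.norm_real, norm_norm,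
          inv_mul_cancel₀ (norm_ne_zero_iff.2 hn)]
      · exact ((Projectivization.mk_eq_mk_iff' ℂ _ _ _ hn).2 ⟨_, rfl⟩).trans (mk_affineRep hx)
      · change (‖affineRep p x‖ : ℂ)⁻¹ • affineRep p x = _
        rw [← Complex.ofReal_inv]
        exact Complex.coe_smul _ _
    · obtain ⟨s, hs⟩ := exists_shape_eq x
      exact ⟨s, hs, fun h => absurd h hx⟩
  choose σ hσ hσ' using hex
  refine ⟨σ, ?_, hσ⟩
  have h : ContMDiffOn 𝓘(ℝ, ShapeModel N) 𝓘(ℝ, CMSpace m) ∞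
      (fun x => (toConf (σ x) : CMSpace m)) (chartDomain p) := by
    intro x hx
    have hd : ContDiffAt ℝ ∞ (fun q : CMSpace m => ‖q‖⁻¹ • q) (affineRep p x) :=
      ((contDiffAt_norm ℝ (affineRep_ne_zero p x)).inv
        (norm_ne_zero_iff.2 (affineRep_ne_zero p x))).smul contDiffAt_id
    exact ((hd.contMDiffAt.comp_contMDiffWithinAt x (contMDiffOn_affineRep p x hx)).congr
      (fun y hy => hσ' y hy) (hσ' x hx))
  have h' : ContMDiffOn 𝓘(ℝ, ShapeModel N) (𝓡 (2 * N - 3)) ∞ (fun x => (σ x).1) (chartDomain p) :=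
    ContMDiffOn.of_coe_sphere (E := CMSpace m) (n := 2 * N - 3) h
  exact fun x hx => (ContMDiffWithinAt.subtypeVal_comp_iff _ _ _ _).1 (h' x hx)

/-- `tangentMk` uses the preferred chart at `shape q`, the hypothesis the chart at `p`. The
trivialization at `p` is injective on its source, so comparing its values suffices. -/
theorem tangentMk_shapeDeriv_eq {p : shapeSpace m} {X : ShapeTangent m}
    (hX : X.proj ∈ chartDomain p) {q : freeConf m} (hq : shape q = X.proj) {h : CMSpace m}
    (hh : affineDeriv (n := N - 2) (unitRep_ne_zero p) (q : CMSpace m) h =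
      (trivializationAt (ShapeModel N) (TangentSpace 𝓘(ℝ, ShapeModel N)) p X).2) :
    tangentMk (shape q) (shapeDeriv q h) = X := by
  have hs : shape q ∈ (chartAt (ShapeModel N) p).source := hq ▸ hX
  have h1 := trivializationAt_mfderiv_shape p q ((shape_mem_chartAt_source p q).1 hs) h
  rw [mfderiv_shape] at h1
  set e := trivializationAt (ShapeModel N)
    (TangentSpace 𝓘(ℝ, ShapeModel N) : shapeSpace m → Type) p
  have hm : X ∈ e.source := e.mem_source.2 hX
  have hm' : tangentMk (shape q) (shapeDeriv q h) ∈ e.source := e.mem_source.2 hs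
  refine e.injOn hm' hm (Prod.ext ?_ (h1.trans hh))
  exact (e.coe_fst hm').trans (hq.trans (e.coe_fst hm).symm)

theorem contMDiffOn_assembleVelocity {F H M : Type*} [NormedAddCommGroup F] [NormedSpace ℝ F]
    [TopologicalSpace H] {I : ModelWithCorners ℝ F H} [TopologicalSpace M] [ChartedSpace H M]
    {U : Set M} {σ : M → freeSphere m} {h : M → CMSpace m} {c : M → ℝ × ℝ}
    (hσ : ContMDiffOn I (𝓡 (2 * N - 3)) ∞ σ U) (hh : ContMDiffOn I 𝓘(ℝ, CMSpace m) ∞ h U)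
    (hc : ContMDiffOn I 𝓘(ℝ, ℝ × ℝ) ∞ c U) :
    ContMDiffOn I 𝓘(ℝ, CMSpace m) ∞ (fun x => assembleVelocity (σ x) (h x) (c x)) U := by
  have hs : ContMDiffOn I 𝓘(ℝ, CMSpace m) ∞ (fun x => (toConf (σ x) : CMSpace m)) U :=
    contMDiff_coe_toConf.comp_contMDiffOn hσ
  have hI : ContMDiffOn I 𝓘(ℝ, CMSpace m) ∞
      (fun x => Complex.I • (toConf (σ x) : CMSpace m)) U :=
    contMDiffOn_complex_smul contMDiffOn_const hs
  have h1 : ContMDiffOn I 𝓘(ℝ, ℝ) ∞ (fun x => (c x).1) U :=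
    (ContinuousLinearMap.fst ℝ ℝ ℝ).contMDiff.comp_contMDiffOn hc
  have h2 : ContMDiffOn I 𝓘(ℝ, ℝ) ∞ (fun x => (c x).2) U :=
    (ContinuousLinearMap.snd ℝ ℝ ℝ).contMDiff.comp_contMDiffOn hc
  refine ((hh.add ((h1.sub (contMDiffOn_inner hs hh)).smul hs)).add
    ((h2.sub (contMDiffOn_inner hI hh)).smul hI)).congr fun x _ => ?_
  exact assembleVelocity_eq _ _ _

theorem smoothToQuotient_of_reducedMap_eq {Ψ : ProductBundle m → ReducedPhaseSpace m}
    (hΨ : ∀ z, Ψ (reducedMap z) = z) :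
    SmoothToQuotient (phaseModel m) (productModel N) Ψ := by
  rintro ⟨r₀, X₀, c₀⟩
  set p := X₀.proj
  obtain ⟨σ, hσ, hσ'⟩ := exists_smooth_section p
  set e := trivializationAt (ShapeModel N)
    (TangentSpace 𝓘(ℝ, ShapeModel N) : shapeSpace m → Type) p
  -- The right inverse of `affineDeriv` at `w = σ [s]`, applied to the tangent vector read in the
  -- trivialization at `p`.
  let h : ProductBundle m → CMSpace m := fun z =>
    ⟪unitRep p, (toConf (σ z.2.1.proj) : CMSpace m)⟫_ℂ •
      ((perpCoord (n := N - 2) (unitRep_ne_zero p)).symm (e z.2.1).2 : CMSpace m)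
  have hproj : ContMDiff (productModel N) 𝓘(ℝ, ShapeModel N) ∞
      fun z : ProductBundle m => z.2.1.proj :=
    (Bundle.contMDiff_proj _).comp (contMDiff_fst.comp contMDiff_snd)
  let U : Set (ProductBundle m) := (fun z => z.2.1.proj) ⁻¹' (chartDomain p)
  have hU : U ∈ 𝓝 ((r₀, X₀, c₀) : ProductBundle m) :=
    ((chartDomain p).isOpen.preimage hproj.continuous).mem_nhds
      (mem_chart_source (ShapeModel N) p)
  have hσU : ContMDiffOn (productModel N) (𝓡 (2 * N - 3)) ∞
      (fun z : ProductBundle m => σ z.2.1.proj) U :=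
    hσ.comp hproj.contMDiffOn fun z hz => hz
  have hh : ContMDiffOn (productModel N) 𝓘(ℝ, CMSpace m) ∞ h U := by
    have h1 : ContMDiffOn (productModel N) 𝓘(ℝ, ℂ) ∞ (fun z : ProductBundle m =>
        ⟪unitRep p, (toConf (σ z.2.1.proj) : CMSpace m)⟫_ℂ) U :=
      ((innerSL ℂ (unitRep p)).restrictScalars ℝ).contMDiff.comp_contMDiffOn
        (contMDiff_coe_toConf.comp_contMDiffOn hσU)
    have h2 : ContMDiffOn (productModel N) 𝓘(ℝ, ShapeModel N) ∞
        (fun z : ProductBundle m => (e z.2.1).2) U :=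
      contMDiff_snd.comp_contMDiffOn (e.contMDiffOn.comp
        (contMDiff_fst.comp contMDiff_snd).contMDiffOn fun z hz => e.mem_source.2 hz)
    exact contMDiffOn_complex_smul h1 ((((Submodule.subtypeL (ℂ ∙ unitRep p)ᗮ).comp
      (perpCoord (n := N - 2) (unitRep_ne_zero
        p)).symm.toContinuousLinearEquiv.toContinuousLinearMap).restrictScalars
          ℝ).contMDiff.comp_contMDiffOn h2)
  refine ⟨U, hU, fun z => (z.1, σ z.2.1.proj, assembleVelocity (σ z.2.1.proj) (h z) z.2.2), ?_, ?_⟩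
  · exact contMDiffOn_fst.prodMk (hσU.prodMk (contMDiffOn_assembleVelocity hσU hh
      (contMDiff_snd.comp contMDiff_snd).contMDiffOn))
  · rintro ⟨r, X, c⟩ hz
    have hX : X.proj ∈ chartDomain p := hz
    -- As `Ψ` undoes `reducedMap`, it is enough that `reducedMap` sends the lifted class to `(r, X,
    -- c)`.
    rw [← hΨ (Quotient.mk _ _)]
    congr 1
    refine Eq.trans ?_ (reducedMap_mk_eq r (σ X.proj) _).symm
    rw [velocityCoord_assembleVelocity]
    refine congrArg (fun Y => ((r, Y, c) : ProductBundle m))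
      (tangentMk_shapeDeriv_eq hX (hσ' X.proj) ?_).symm
    refine affineDeriv_perpCoord_symm (unitRep_ne_zero p) ?_ _
    rw [← shape_mem_chartAt_source, hσ']
    exact hX

end LocalSection

/-! ### `Φ` as a homeomorphism -/

section ReducedHomeomorph

theorem continuous_of_smoothToQuotient {Ψ : ProductBundle m → ReducedPhaseSpace m}
    (hΨ : SmoothToQuotient (phaseModel m) (productModel N) Ψ) : Continuous Ψ := by
  rw [continuous_iff_continuousAt]
  intro z
  obtain ⟨U, hU, σ, hσ, hσ'⟩ := hΨ z
  have h : ContinuousAt (fun z => (Quotient.mk _ (σ z) : ReducedPhaseSpace m)) z :=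
    continuous_quotient_mk'.continuousAt.comp (hσ.continuousOn.continuousAt hU)
  exact h.congr (Filter.eventually_of_mem hU fun y hy => (hσ' y hy).symm)

/-- The bijection of the reduced phase space with `[0, ∞) × T(ℂℙ^{N-2} ∖ 𝒞) × ℝ²`. -/
def reducedEquiv : ReducedPhaseSpace m ≃ ProductBundle m :=
  Equiv.ofBijective reducedMap bijective_reducedMap

theorem smoothToQuotient_reducedEquiv_symm :
    SmoothToQuotient (phaseModel m) (productModel N) (reducedEquiv (m := m)).symm :=
  smoothToQuotient_of_reducedMap_eq reducedEquiv.symm_apply_apply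

/-- The homeomorphism of the reduced phase space with `[0, ∞) × T(ℂℙ^{N-2} ∖ 𝒞) × ℝ²`. -/
def reducedHomeomorph : ReducedPhaseSpace m ≃ₜ ProductBundle m where
  toEquiv := reducedEquiv
  continuous_toFun :=
    continuous_quot_lift _ (smoothFromQuotient_reducedMap (m := m)).continuous
  continuous_invFun := continuous_of_smoothToQuotient smoothToQuotient_reducedEquiv_symm

end ReducedHomeomorph

/-! ### Rates of change of size and shape along a motion -/

section Motion

theorem hasDerivAt_norm_curve {E : Type*} [NormedAddCommGroup E] [InnerProductSpace ℝ E]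
    {q : ℝ → E} {v : E} {t : ℝ} (hq : HasDerivAt q v t) (h0 : q t ≠ 0) :
    HasDerivAt (fun t => ‖q t‖) (⟪q t, v⟫_ℝ / ‖q t‖) t := by
  have h := (hq.norm_sq).sqrt (pow_ne_zero 2 (norm_ne_zero_iff.2 h0))
  simp only [Real.sqrt_sq (norm_nonneg _)] at h
  convert h using 1
  field_simp

variable {r : ℝ} {s : freeSphere m} {y : CMSpace m} {q : ℝ → freeConf m} {t₀ : ℝ}

theorem hasDerivAt_size (hr : 0 < r) (hq : (q t₀ : CMSpace m) = r • (toConf s : CMSpace m))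
    (hv : HasDerivAt (fun t => (q t : CMSpace m)) (r ^ (-1 / 2 : ℝ) • y) t₀) :
    HasDerivAt (fun t => ‖(q t : CMSpace m)‖)
      (r ^ (-1 / 2 : ℝ) * ⟪(toConf s : CMSpace m), y⟫_ℝ) t₀ := by
  refine (hasDerivAt_norm_curve hv (NoCollision.ne_zero (q t₀).2)).congr_deriv ?_
  rw [hq, norm_smul, norm_toConf, real_inner_smul_left, real_inner_smul_right,
    Real.norm_of_nonneg hr.le]
  field_simp

theorem hasMFDerivAt_shape_curve (hr : 0 < r)
    (hq : (q t₀ : CMSpace m) = r • (toConf s : CMSpace m))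
    (hv : HasDerivAt (fun t => (q t : CMSpace m)) (r ^ (-1 / 2 : ℝ) • y) t₀) :
    shape (q t₀) = shape (toConf s) ∧
    HasMFDerivAt 𝓘(ℝ, ℝ) 𝓘(ℝ, ShapeModel N) (fun t => shape (q t)) t₀
      (ContinuousLinearMap.toSpanSingleton ℝ
        (r ^ (-3 / 2 : ℝ) • shapeDeriv (toConf s) y)) := by
  have hr' : (r : ℂ) ≠ 0 := Complex.ofReal_ne_zero.2 hr.ne'
  have hq' : (q t₀ : CMSpace m) = (r : ℂ) • (toConf s : CMSpace m) :=
    hq.trans (Complex.coe_smul _ _).symm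
  have hd := shapeDeriv_smul_smul hr' hq' (r ^ (-3 / 2 : ℝ) • y)
  -- The position is `r • s`, so homogeneity requires the velocity as `r` times a vector: here the
  -- exponent `-3/2` appears.
  have hrr : r ^ (-1 / 2 : ℝ) • y = (r : ℂ) • r ^ (-3 / 2 : ℝ) • y := by
    rw [Complex.coe_smul, smul_smul, ← Real.rpow_one_add' hr.le] <;> norm_num
  refine ⟨hd.1, ?_⟩
  have h := (hasMFDerivAt_shape (q t₀)).comp t₀ (hasMFDerivAt_opens_curve hv)
  have hL : (shapeDeriv (q t₀)).comp (ContinuousLinearMap.toSpanSingleton ℝ (r ^ (-1 / 2 : ℝ) • y)) =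
      ContinuousLinearMap.toSpanSingleton ℝ (r ^ (-3 / 2 : ℝ) • shapeDeriv (toConf s) y) := by
    ext1
    rw [ContinuousLinearMap.comp_apply, ContinuousLinearMap.toSpanSingleton_apply,
      ContinuousLinearMap.toSpanSingleton_apply, one_smul, one_smul, hrr, hd.2, map_smul]
  exact hL ▸ h

end Motion

end PlanarNBody

end

theorem mainTheorem1 (N : ℕ) [N.AtLeastTwo] (m : Masses N) :
    ∃ Φ : ReducedPhaseSpace m ≃ₜ ProductBundle m,
      -- `Φ` is a diffeomorphism
      SmoothFromQuotient (phaseModel m) (productModel N) Φ ∧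
      SmoothToQuotient (phaseModel m) (productModel N) Φ.symm ∧
      -- `Φ` covers the identity of `[0, ∞) × (ℂℙ^{N-2} ∖ 𝒞)` and is a linear isomorphism on the fibres
      (∃ L : ∀ b : ℝ≥0 × shapeSpace m,
          Fiber b ≃ₗ[ℝ] TangentSpace 𝓘(ℝ, ShapeModel N) b.2 × (ℝ × ℝ),
        ∀ (b : ℝ≥0 × shapeSpace m) (z : Fiber b), Φ z.1 = (b.1, ⟨b.2, (L b z).1⟩, (L b z).2)) ∧
      -- the components of `Φ` are the size, the horizontal shape velocity, and `(ν, J̃)`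
      (∀ (r : ℝ≥0) (s : freeSphere m) (y : CMSpace m),
        Φ (ReducedPhaseSpace.mk r s y) =
          (r, shapeVelocity s y,
            (⟪(toConf s : CMSpace m), y⟫_ℝ, ⟪Complex.I • (toConf s : CMSpace m), y⟫_ℝ))) ∧
      -- off `r = 0`: `J̃ = r^{-1/2} J(q, v)` where `q = r s`, `v = r^{-1/2} y`
      (∀ (r : ℝ≥0) (s : freeSphere m) (y : CMSpace m), 0 < r →
        (Φ (ReducedPhaseSpace.mk r s y)).2.2.2 = (r : ℝ) ^ (-1 / 2 : ℝ) *
          angularMomentum ((r : ℝ) • (toConf s : CMSpace m)) ((r : ℝ) ^ (-1 / 2 : ℝ) • y)) ∧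
      -- off `r = 0`: along a collision-free motion through `(q, v) = (r s, r^{-1/2} y)` the size has
      -- rate of change `r^{-1/2} ν` and the shape has velocity `r^{-3/2}` times the shape velocity
      (∀ (r : ℝ≥0) (s : freeSphere m) (y : CMSpace m), 0 < r →
        ∀ (q : ℝ → freeConf m) (t₀ : ℝ), (q t₀ : CMSpace m) = (r : ℝ) • (toConf s : CMSpace m) →
          HasDerivAt (fun t => (q t : CMSpace m)) ((r : ℝ) ^ (-1 / 2 : ℝ) • y) t₀ →
          HasDerivAt (fun t => ‖(q t : CMSpace m)‖)
            ((r : ℝ) ^ (-1 / 2 : ℝ) * (Φ (ReducedPhaseSpace.mk r s y)).2.2.1) t₀ ∧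
          shape (q t₀) = (Φ (ReducedPhaseSpace.mk r s y)).2.1.proj ∧
          HasMFDerivAt 𝓘(ℝ, ℝ) 𝓘(ℝ, ShapeModel N) (fun t => shape (q t)) t₀
            (ContinuousLinearMap.toSpanSingleton ℝ
              ((r : ℝ) ^ (-3 / 2 : ℝ) • (Φ (ReducedPhaseSpace.mk r s y)).2.1.snd))) := by
  refine ⟨reducedHomeomorph, smoothFromQuotient_reducedMap, smoothToQuotient_reducedEquiv_symm,
    ⟨fiberVelocityEquiv, reducedMap_fiber⟩, reducedMap_mk, ?_, ?_⟩
  · intro r s y hr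
    exact inner_I_smul_eq_angularMomentum hr _ y
  · intro r s y hr q t₀ hq hv
    obtain ⟨h1, h2⟩ := hasMFDerivAt_shape_curve hr hq hv
    refine ⟨hasDerivAt_size hr hq hv, h1, ?_⟩
    have h3 : (reducedHomeomorph (ReducedPhaseSpace.mk r s y)).2.1 =
        tangentMk (shape (toConf s)) (shapeDeriv (toConf s) y) := shapeVelocity_eq s y
    rw [h3]
    exact h2
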